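/- Conventions. A cubespace is a metric space $X$ with closed sets $C^k(X)\subseteq X^{\{0,1\}^k}$ of $k$-cubes for all $k\ge 0$, with $C^0(X)=X$, such that $c\circ\rho\in C^k(X)$ whenever $c\in C^\ell(X)$ and each coordinate of $\rho\colon\{0,1\}^k\to\{0,1\}^\ell$ is $0$, $1$, some $x_j$ or some $1-x_j$. It is ergodic if $C^1(X)=X^2$, and has the glueing property if, whenever $c,c'\in C^k(X)$ with $k\ge1$ and $c(\omega 1)=c'(\omega 0)$ for all $\omega\in\{0,1\}^{k-1}$, the configuration equal to $c$ on $\{\omega_k=0\}$ and to $c'$ on $\{\omega_k=1\}$ is in $C^k(X)$. A $k$-corner in $X$ is a map $\lambda\colon\{0,1\}^k\setminus\{\vec 1\}\to X$ whose restriction to each face $\{\omega_i=0\}$ is a $(k-1)$-cube. A continuous map $f\colon X\to Y$ of cubespaces that sends cubes to cubes is a fibration if, for all $k\ge0$, every $k$-corner $\lambda$ in $X$ and every $c\in C^k(Y)$ with $f\circ\lambda=c$ off $\vec 1$, there is $\tilde c\in C^k(X)$ extending $\lambda$ with $f\circ\tilde c=c$. It has $k$-uniqueness if two $k$-cubes of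 $X$ that have the same image under $f$ and agree off $\vec 1$ are equal; a fibration has degree at most $s$ if it has $k$-uniqueness for some $k\le s+1$. The map $f$ is relatively $s$-ergodic if, for $1\le\ell\le s$, every configuration $c\in X^{\{0,1\}^\ell}$ with $f\circ c\in C^\ell(Y)$ is a cube of $X$. For an abelian group $A$, $C^k(\mathcal D_s(A))$ is the subgroup of $A^{\{0,1\}^k}$ generated by the configurations equal to $a\in A$ on $\{\omega:\omega_i=1\ \forall i\in S\}$ and $0$ elsewhere, where $S\subseteq\{1,\dots,k\}$ and $|S|\le s$. Theorem. Let $s\ge 0$, let $X$ and $Y$ be non-empty compact ergodic cubespaces with the glueing property, and let $f\colon X\to Y$ be a relatively $s$-ergodic fibration of degree at most $s$. On $M=\{[x,x']\in X\times X: f(x)=f(x')\}$ let $[x,x']\sim[y,y']$ if there are two maps $c,c'\colon\{0,1\}^s\to C^1(X)\subseteq X\times X$ which, viewed as elements of $X^{\{0,1\}^{s+1}}$, are $(s+1)$-cubes of $X$, which agree off $\vec 1$, and which satisfy $c(\vec 1)=[x,y]$, $c'(\vec 1)=[x',y']$. Then $\sim$ is an equivalence relation, and $A=A(f)=M/{\sim}$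 with the quotient topology is a compact metrizable abelian group under the addition determined by $[x,y]+[y,z]=[x,z]$. Moreover $A$ acts continuously on $X$, the class of $[x,x']$ sending $x$ to $x'$, in such a way that: (i) the action of $A$ on $X$ is free, and its orbits are precisely the fibres of $f$; (ii) for every $k\ge 0$, acting pointwise, $C^k(\mathcal D_s(A))$ maps $C^k(X)$ to itself; this action on $C^k(X)$ is free, and its orbits are precisely the fibres of the map $f\colon C^k(X)\to C^k(Y)$. -/

import Mathlib

/-- The discrete cube `{0,1}^k`, with `false` for `0` and `true` for `1`. -/
abbrev DCube (k : ℕ) : Type := Fin k → Bool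

/-- The vertex `(1, …, 1)`. -/
def DCube.one (k : ℕ) : DCube k := fun _ => true

/-- Morphisms of discrete cubes: every coordinate of `ρ` is identically `0`, identically `1`,
some `x_j`, or some `1 - x_j`. -/
def IsDCubeMorphism {k l : ℕ} (ρ : DCube k → DCube l) : Prop :=
  ∀ i : Fin l, (∀ x, ρ x i = false) ∨ (∀ x, ρ x i = true) ∨
    (∃ j, ∀ x, ρ x i = x j) ∨ (∃ j, ∀ x, ρ x i = !(x j))

/-- A cubespace: a metric space with closed sets `C^k` of `k`-cubes for all `k ≥ 0`, stable under
precomposition with morphisms of discrete cubes, all `0`-dimensional configurations being cubes. -/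
class Cubespace (X : Type*) [MetricSpace X] where
  cubes : (k : ℕ) → Set (DCube k → X)
  isClosed_cubes : ∀ k, IsClosed (cubes k)
  comp_mem : ∀ {k l : ℕ} (ρ : DCube k → DCube l), IsDCubeMorphism ρ →
    ∀ c ∈ cubes l, c ∘ ρ ∈ cubes k
  cubes_zero : cubes 0 = Set.univ

/-- The set `C^k(X)` of `k`-cubes. -/
def cubes (X : Type*) [MetricSpace X] [Cubespace X] (k : ℕ) : Set (DCube k → X) :=
  Cubespace.cubes k

/-- The configuration `[x, y]` on `{0,1}^1`. -/
def edgeConfig {X : Type*} (p : X × X) : DCube 1 → X :=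
  fun ω => if ω 0 = true then p.2 else p.1

/-- Every pair of points is a `1`-cube. -/
def IsErgodicCubespace (X : Type*) [MetricSpace X] [Cubespace X] : Prop :=
  cubes X 1 = Set.univ

/-- Glueing two cubes along a common face (in the last coordinate) gives a cube. -/
def HasGlueing (X : Type*) [MetricSpace X] [Cubespace X] : Prop :=
  ∀ (n : ℕ), ∀ c ∈ cubes X (n + 1), ∀ c' ∈ cubes X (n + 1),
    (∀ ω : DCube n, c (Fin.snoc (α := fun _ => Bool) ω true) =
      c' (Fin.snoc (α := fun _ => Bool) ω false)) →
    (fun ω : DCube (n + 1) => if ω (Fin.last n) = true then c' ω else c ω) ∈ cubes X (n + 1)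

/-- Insertion of a `0` at position `i`, as a vertex different from `(1, …, 1)`. -/
def lowerFaceVertex {n : ℕ} (i : Fin (n + 1)) (ω : DCube n) :
    {ω : DCube (n + 1) // ω ≠ DCube.one (n + 1)} :=
  ⟨Fin.insertNth (α := fun _ => Bool) i false ω, fun h => by
    have h1 := congrFun h i
    simp [DCube.one] at h1⟩

/-- `k`-corners: configurations on `{0,1}^k` minus `(1, …, 1)` all of whose
codimension one lower faces are cubes (no condition for `k = 0`). -/
def IsCubeCorner {X : Type*} [MetricSpace X] [Cubespace X] :
    (k : ℕ) → ({ω : DCube k // ω ≠ DCube.one k} → X) → Prop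
  | 0, _ => True
  | n + 1, lam => ∀ i : Fin (n + 1), (fun ω => lam (lowerFaceVertex i ω)) ∈ cubes X n

/-- Cubespace morphisms: continuous maps sending cubes to cubes. -/
structure IsCubespaceMorphism {X Y : Type*} [MetricSpace X] [Cubespace X]
    [MetricSpace Y] [Cubespace Y] (f : X → Y) : Prop where
  continuous : Continuous f
  map_cubes : ∀ (k : ℕ), ∀ c ∈ cubes X k, f ∘ c ∈ cubes Y k

/-- Fibrations: a corner of `X` together with a completion to a cube in `Y` of its image can be
completed to a compatible cube of `X`. -/
structure IsFibration {X Y : Type*} [MetricSpace X] [Cubespace X]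
    [MetricSpace Y] [Cubespace Y] (f : X → Y) : Prop extends IsCubespaceMorphism f where
  lift : ∀ (k : ℕ), ∀ c ∈ cubes Y k, ∀ lam : {ω : DCube k // ω ≠ DCube.one k} → X,
    IsCubeCorner k lam → (∀ ω, f (lam ω) = c ω.1) →
    ∃ c' ∈ cubes X k, (∀ ω, c' ω.1 = lam ω) ∧ f (c' (DCube.one k)) = c (DCube.one k)

/-- Relative `k`-uniqueness of `f`. -/
def HasRelUniqueness {X Y : Type*} [MetricSpace X] [Cubespace X]
    (f : X → Y) (k : ℕ) : Prop :=
  ∀ c ∈ cubes X k, ∀ c' ∈ cubes X k, f ∘ c = f ∘ c' →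
    (∀ ω, ω ≠ DCube.one k → c ω = c' ω) → c = c'

/-- The smallest `k` for which `f` has `k`-uniqueness satisfies `k - 1 ≤ s`. -/
def RelDegreeAtMost {X Y : Type*} [MetricSpace X] [Cubespace X]
    (f : X → Y) (s : ℕ) : Prop :=
  ∃ k ≤ s + 1, HasRelUniqueness f k

/-- Relative `k`-ergodicity: for `1 ≤ l ≤ k`, all configurations above an `l`-cube of `Y` are
cubes. -/
def IsRelErgodic {X Y : Type*} [MetricSpace X] [Cubespace X]
    [MetricSpace Y] [Cubespace Y] (f : X → Y) (k : ℕ) : Prop :=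
  ∀ l, 1 ≤ l → l ≤ k → ∀ c : DCube l → X, f ∘ c ∈ cubes Y l → c ∈ cubes X l

/-- `x` and `x'` are the values at `(1, …, 1)` of two `n`-cubes that agree at all other vertices.
For `n = k + 1` this is the canonical relation `∼_k`. -/
def canonicalRel {X : Type*} [MetricSpace X] [Cubespace X] (n : ℕ) (x x' : X) : Prop :=
  ∃ c ∈ cubes X n, ∃ c' ∈ cubes X n, c (DCube.one n) = x ∧ c' (DCube.one n) = x' ∧
    ∀ ω, ω ≠ DCube.one n → c ω = c' ω

/-- The underlying space `C^1(X) ⊆ X × X` of the edge cubespace. -/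
abbrev EdgeSpace (X : Type*) [MetricSpace X] [Cubespace X] : Type _ :=
  {p : X × X // edgeConfig p ∈ cubes X 1}

/-- The identification of configurations of edges on `{0,1}^k` with configurations
on `{0,1}^(k+1)`. -/
def unfoldEdges {X : Type*} [MetricSpace X] [Cubespace X] {k : ℕ} (c : DCube k → EdgeSpace X) :
    DCube (k + 1) → X :=
  fun ω => if ω (Fin.last k) = true then (c (fun i => ω i.castSucc)).1.2
    else (c (fun i => ω i.castSucc)).1.1

/-- The edge cubespace of `X`: its `k`-cubes correspond to the `(k+1)`-cubes of `X`. -/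
instance edgeCubespace (X : Type*) [MetricSpace X] [Cubespace X] : Cubespace (EdgeSpace X) where
  cubes k := {c | unfoldEdges c ∈ cubes X (k + 1)}
  isClosed_cubes k := by
    refine (Cubespace.isClosed_cubes (X := X) (k + 1)).preimage ?_
    refine continuous_pi fun ω => ?_
    unfold unfoldEdges
    split_ifs <;> fun_prop
  comp_mem {k l} ρ hρ c hc := by
    let ρ' : DCube (k + 1) → DCube (l + 1) := fun ω =>
      Fin.snoc (α := fun _ => Bool) (ρ (fun i => ω i.castSucc)) (ω (Fin.last k))
    have h1 : IsDCubeMorphism ρ' := by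
      intro i
      refine Fin.lastCases ?_ (fun i => ?_) i
      · exact Or.inr (Or.inr (Or.inl ⟨Fin.last k, fun x => by simp [ρ']⟩))
      · rcases hρ i with h | h | ⟨j, h⟩ | ⟨j, h⟩
        · exact Or.inl fun x => by simp [ρ', h]
        · exact Or.inr (Or.inl fun x => by simp [ρ', h])
        · exact Or.inr (Or.inr (Or.inl ⟨j.castSucc, fun x => by simp [ρ', h]⟩))
        · exact Or.inr (Or.inr (Or.inr ⟨j.castSucc, fun x => by simp [ρ', h]⟩))
    have h2 : unfoldEdges (c ∘ ρ) = unfoldEdges c ∘ ρ' := by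
      funext ω
      simp [unfoldEdges, ρ']
    have h3 := Cubespace.comp_mem (X := X) ρ' h1 (unfoldEdges c) hc
    rw [← h2] at h3
    exact h3
  cubes_zero := by
    refine Set.eq_univ_of_forall fun c => ?_
    have h : unfoldEdges c = edgeConfig (c (fun i => i.elim0)).1 := by
      funext ω
      have h0 : (fun i : Fin 0 => ω i.castSucc) = fun i => i.elim0 := funext fun i => i.elim0
      simp only [unfoldEdges, edgeConfig, h0]
      rfl
    change unfoldEdges c ∈ cubes X 1
    rw [h]
    exact (c _).2

/-- The space of pairs of points lying in the same fibre of `f`. -/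
abbrev FibrePairs {X Y : Type*} (f : X → Y) : Type _ := {p : X × X // f p.1 = f p.2}

/-- `[x, x'] ∼ [y, y']` if `[x, y]` and `[x', y']` are edges of `X` that are related by the canonical
relation `∼_(s-1)` of the edge cubespace (note the rotation). For `s = 0`, when there is no `∼_(s-1)`,
the relation given by `0`-cubes is used; it relates any two edges. -/
def structureRel {X Y : Type*} [MetricSpace X] [Cubespace X] (f : X → Y) (s : ℕ)
    (p q : FibrePairs f) : Prop :=
  ∃ (h : edgeConfig (p.1.1, q.1.1) ∈ cubes X 1) (h' : edgeConfig (p.1.2, q.1.2) ∈ cubes X 1),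
    canonicalRel s (⟨(p.1.1, q.1.1), h⟩ : EdgeSpace X) ⟨(p.1.2, q.1.2), h'⟩

/-- The structure group `A(f)` of `f`, as a topological space: the space of pairs in a common fibre
modulo `structureRel f s`, with the quotient topology. -/
abbrev StructureGroup {X Y : Type*} [MetricSpace X] [Cubespace X] (f : X → Y) (s : ℕ) : Type _ :=
  Quot (structureRel f s)

/-- The class in `A(f)` of the pair `[x, y]`. -/
def StructureGroup.mk {X Y : Type*} [MetricSpace X] [Cubespace X] (f : X → Y) (s : ℕ)
    (x y : X) (h : f x = f y) : StructureGroup f s :=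
  Quot.mk _ ⟨(x, y), h⟩

/-- The Host–Kra cube group `HK^k` of an additive group with a filtration `F`: the group generated
by the configurations equal to `x` on the upper face `{ω : ω ⊇ S}` and `0` elsewhere, where
`S ⊆ [k]` and `x ∈ F |S|`. -/
def hostKra {A : Type*} [AddGroup A] (F : ℕ → AddSubgroup A) (k : ℕ) :
    AddSubgroup (DCube k → A) :=
  AddSubgroup.closure {g | ∃ S : Finset (Fin k), ∃ x ∈ F S.card,
    g = fun ω => if ∀ i ∈ S, ω i = true then x else 0}

/-- The cubes `C^k(D_s(A))`: the Host–Kra cubes for the filtration `A = A_0 = … = A_s ⊇ {0}`. -/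
def degreeCubes (A : Type*) [AddGroup A] (s k : ℕ) : AddSubgroup (DCube k → A) :=
  hostKra (fun i => if i ≤ s then ⊤ else ⊥) k

/-- The orbit of a configuration `c` in `X` under the pointwise action of `C^k(D_s(A))`. -/
def cubeOrbit (A : Type*) {X : Type*} [AddGroup A] [AddAction A X] (s : ℕ) {k : ℕ}
    (c : DCube k → X) : Set (DCube k → X) :=
  {c' | ∃ a ∈ degreeCubes A s k, c' = fun ω => a ω +ᵥ c ω}

/-!
The proof is a calculus of edges in `(s+1)`-cubes of `X`.

Folding (`HasGlueing.structConfig_mem`) shows that two pairs `[x, x']` and `[y, y']` in fibres of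
`f` are related if and only if one explicit configuration is an `(s+1)`-cube: the one equal to
`[x', y']` on the edge `(1, …, 1, *)` and to `[x, y]` on all parallel edges. Glueing then
makes the relation an equivalence relation compatible with concatenation of pairs. Given `[x, x']`
and `y`, the fibration property and relative ergodicity produce a `y'` with `[x, x'] ∼ [y, y']`, and
it is unique because `f` has `(s+1)`-uniqueness. So each class `a` acts on `X`
(`IsDegreeFibration.act`), freely and with the fibres of `f` as orbits.

The central fact is `IsDegreeFibration.act_edge_mem`: applying `a` at both ends of an edge of an
`(s+1)`-cube gives a cube. Applying `a` and `b` to two edges with a common vertex, in either order,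
shows by uniqueness that the structure group is abelian. Moreover, moving values along edges, any
configuration of group elements on `{0,1}^(s+1)` can be concentrated at `(1, …, 1)`, where its
alternating sum remains; by uniqueness it maps a cube to a cube if and only if that sum vanishes
(`IsEdgeAction.vadd_mem_iff_altSum`). In dimension `k`, a configuration of group elements therefore
maps a cube to a cube if and only if its alternating sums over all `(s+1)`-dimensional cubes vanish,
and a discrete Taylor expansion identifies the configurations with this property with
`C^k(D_s(A))` (`mem_degreeCubes_iff`). As cubes lift along fibrations
(`IsFibration.exists_lift_cube`), the orbits in `C^k(X)` are exactly the fibres over `C^k(Y)`.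

For the topology, all relevant graphs are closed because the sets of cubes are, so compactness makes
the action continuous; the structure group is homeomorphic to a fibre of `f`, hence metrizable.
-/

/-! ### Cubes, glueing and folding -/

/-- The configuration on `{0,1}^(s+1)` equal to `[x', y']` on the edge
`{ω | ω i = 1 for all i ≠ last}` and to `[x, y]` on all parallel edges. -/
def structConfig (s : ℕ) {X : Type*} (x x' y y' : X) : DCube (s + 1) → X := fun ω =>
  if ∀ i, i ≠ Fin.last s → ω i = true then (if ω (Fin.last s) = true then y' else x')
  else (if ω (Fin.last s) = true then y else x)

/-- The vertex `(1, …, 1, b)`. -/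
def topEdge (s : ℕ) (b : Bool) : DCube (s + 1) := fun i => if i = Fin.last s then b else true

lemma topEdge_true (s : ℕ) : topEdge s true = DCube.one (s + 1) := by
  funext i; simp [topEdge, DCube.one]

lemma topEdge_cond (s : ℕ) (b : Bool) : ∀ i, i ≠ Fin.last s → topEdge s b i = true := by
  intro i hi; simp [topEdge, hi]

@[simp] lemma topEdge_last (s : ℕ) (b : Bool) : topEdge s b (Fin.last s) = b := by
  simp [topEdge]

lemma eq_topEdge {s : ℕ} {ω : DCube (s + 1)} (h : ∀ i, i ≠ Fin.last s → ω i = true) :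
    ω = topEdge s (ω (Fin.last s)) := by
  funext i
  by_cases hi : i = Fin.last s
  · subst hi; simp
  · simp [topEdge, hi, h i hi]

@[simp] lemma structConfig_topEdge (s : ℕ) {X : Type*} (x x' y y' : X) (b : Bool) :
    structConfig s x x' y y' (topEdge s b) = if b = true then y' else x' := by
  rw [structConfig, if_pos (topEdge_cond s b), topEdge_last]

section Cubes

variable {X : Type*} [MetricSpace X] [Cubespace X]

lemma comp_mem_cubes {k l : ℕ} {ρ : DCube k → DCube l} (hρ : IsDCubeMorphism ρ)
    {c : DCube l → X} (hc : c ∈ cubes X l) : c ∘ ρ ∈ cubes X k :=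
  Cubespace.comp_mem ρ hρ c hc

lemma isClosed_cubes (k : ℕ) : IsClosed (cubes X k) :=
  Cubespace.isClosed_cubes k

lemma mem_cubes_zero (c : DCube 0 → X) : c ∈ cubes X 0 := by
  unfold cubes
  rw [Cubespace.cubes_zero]
  trivial

lemma const_mem_cubes (k : ℕ) (x : X) : (fun _ => x) ∈ cubes X k :=
  comp_mem_cubes (ρ := fun _ : DCube k => (fun i => i.elim0 : DCube 0)) (fun i => i.elim0)
    (mem_cubes_zero fun _ => x)

lemma isDCubeMorphism_insertNth {n : ℕ} (i : Fin (n + 1)) (b : Bool) :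
    IsDCubeMorphism (fun ω : DCube n => Fin.insertNth (α := fun _ => Bool) i b ω) := by
  intro j
  refine Fin.succAboveCases i ?_ (fun j => ?_) j
  · cases b
    · exact Or.inl fun x => by simp
    · exact Or.inr (Or.inl fun x => by simp)
  · exact Or.inr (Or.inr (Or.inl ⟨j, fun x => by simp⟩))

/-- The map `σ` need not be injective: permutations, projections and diagonals are covered. -/
lemma isDCubeMorphism_perm {k l : ℕ} (σ : Fin l → Fin k) :
    IsDCubeMorphism (fun (ω : DCube k) i => ω (σ i)) :=
  fun i => Or.inr (Or.inr (Or.inl ⟨σ i, fun _ => rfl⟩))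

lemma isDCubeMorphism_permXor {k l : ℕ} (σ : Fin l → Fin k) (b : Fin l → Bool) :
    IsDCubeMorphism (fun (ω : DCube k) i => (ω (σ i)) ^^ b i) := by
  intro i
  cases h : b i
  · exact Or.inr (Or.inr (Or.inl ⟨σ i, fun _ => by simp [h]⟩))
  · exact Or.inr (Or.inr (Or.inr ⟨σ i, fun _ => by simp [h]⟩))

lemma isDCubeMorphism_or {k : ℕ} (v : DCube k) :
    IsDCubeMorphism (fun (ω : DCube k) i => ω i || v i) := by
  intro i
  cases h : v i
  · exact Or.inr (Or.inr (Or.inl ⟨i, fun _ => by simp [h]⟩))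
  · exact Or.inr (Or.inl fun _ => by simp [h])

/-- Cubes can be glued along a common face in any coordinate, not just the last one. -/
lemma HasGlueing.glue (hX : HasGlueing X) {n : ℕ} {c c' : DCube (n + 1) → X}
    (hc : c ∈ cubes X (n + 1)) (hc' : c' ∈ cubes X (n + 1)) (i : Fin (n + 1))
    (h : ∀ ω, c (Function.update ω i true) = c' (Function.update ω i false)) :
    (fun ω => if ω i = true then c' ω else c ω) ∈ cubes X (n + 1) := by
  let σ : DCube (n + 1) → DCube (n + 1) := fun ω j => ω (Equiv.swap i (Fin.last n) j)
  have hσ : IsDCubeMorphism σ := isDCubeMorphism_perm _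
  have hσσ : ∀ ω, σ (σ ω) = ω := fun ω => funext fun j => by simp [σ]
  have hsnoc : ∀ (ω : DCube n) (b b' : Bool), σ (Fin.snoc (α := fun _ => Bool) ω b) =
      Function.update (σ (Fin.snoc (α := fun _ => Bool) ω b')) i b := by
    intro ω b b'
    funext j
    by_cases hj : j = i
    · subst hj
      simp [σ]
    · have : Equiv.swap i (Fin.last n) j ≠ Fin.last n := fun e =>
        hj (by simpa using congrArg (Equiv.swap i (Fin.last n)) e)
      obtain ⟨m, hm⟩ := Fin.exists_castSucc_eq.2 this
      simp [σ, hj, ← hm]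
  have key := comp_mem_cubes hσ (hX n _ (comp_mem_cubes hσ hc) _ (comp_mem_cubes hσ hc')
    fun ω => by
      have h1 := h (σ (Fin.snoc (α := fun _ => Bool) ω true))
      rwa [← hsnoc, ← hsnoc] at h1)
  refine Eq.mp (congrArg (· ∈ cubes X (n + 1)) ?_) key
  funext ω
  have h2 : (σ ω) (Fin.last n) = ω i := by simp [σ]
  simp only [Function.comp_apply, h2, hσσ]

/-- If two cubes agree on `{ω | ω i = 0}`, then their faces `{ω | ω i = 1}` are the two opposite
faces of a cube: glue the reflection of the first cube to the second one. -/
lemma HasGlueing.fold (hX : HasGlueing X) {n : ℕ} {c c' : DCube (n + 1) → X}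
    (hc : c ∈ cubes X (n + 1)) (hc' : c' ∈ cubes X (n + 1)) (i : Fin (n + 1))
    (h : ∀ ω, ω i = false → c ω = c' ω) :
    (fun ω => if ω i = true then c' ω else c (Function.update ω i true)) ∈ cubes X (n + 1) := by
  let b : DCube (n + 1) := fun j => decide (j = i)
  have hr := isDCubeMorphism_permXor (fun j => j) b
  have hb : ∀ (ω : DCube (n + 1)) (t : Bool),
      (fun j => Function.update ω i t j ^^ b j) = Function.update ω i (!t) := by
    intro ω t
    funext j
    by_cases hj : j = i
    · subst hj; simp [b]
    · simp [b, hj]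
  have key := hX.glue (comp_mem_cubes hr hc) hc' i fun ω => by
    simp only [Function.comp_apply, hb]
    exact h _ (by simp)
  refine Eq.mp (congrArg (· ∈ cubes X (n + 1)) ?_) key
  funext ω
  by_cases hω : ω i = true
  · simp [hω]
  · have h1 := hb ω (ω i)
    rw [Function.update_eq_self] at h1
    have h2 : ω i = false := by simpa using hω
    simp only [Function.comp_apply, h1, h2]
    simp

/-- Folding two cubes that agree off the edge `{ω | ω i = 1 for all i ≠ last}` along all
coordinates but the last. -/
lemma HasGlueing.structConfig_mem (hX : HasGlueing X) {s : ℕ} {c c' : DCube (s + 1) → X}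
    (hc : c ∈ cubes X (s + 1)) (hc' : c' ∈ cubes X (s + 1))
    (h : ∀ ω, ¬ (∀ i, i ≠ Fin.last s → ω i = true) → c ω = c' ω) :
    structConfig s (c (topEdge s false)) (c' (topEdge s false)) (c (topEdge s true))
      (c' (topEdge s true)) ∈ cubes X (s + 1) := by
  have key : ∀ T : Finset (Fin (s + 1)), Fin.last s ∉ T →
      (fun ω : DCube (s + 1) => if ∀ i, i ≠ Fin.last s → ω i = true then c' ω
        else c (fun j => ω j || decide (j ∈ T))) ∈ cubes X (s + 1) := by
    intro T
    induction T using Finset.induction_on with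
    | empty =>
      intro _
      refine Eq.mp (congrArg (· ∈ cubes X (s + 1)) ?_) hc'
      funext ω
      split_ifs with hω
      · rfl
      · simp [h ω hω]
    | insert i T hi ih =>
      intro hT
      simp only [Finset.mem_insert, not_or] at hT
      have h1 := hX.fold (comp_mem_cubes (isDCubeMorphism_or fun j => decide (j ∈ T)) hc)
        (ih hT.2) i fun ω hω => by
          rw [if_neg fun h => by simp [h i (Ne.symm hT.1)] at hω]
          rfl
      refine Eq.mp (congrArg (· ∈ cubes X (s + 1)) ?_) h1
      funext ω
      have hu : ω i = true → (fun j => ω j || decide (j ∈ T)) =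
          fun j => ω j || decide (j ∈ insert i T) := by
        intro hω
        funext j
        by_cases hj : j = i
        · subst hj; simp [hω]
        · simp [hj]
      by_cases hω : ω i = true
      · simp only [hω, if_true, hu hω]
      · have hn : ¬ ∀ i, i ≠ Fin.last s → ω i = true := fun h => hω (h i (Ne.symm hT.1))
        simp only [hω, if_neg hn, Function.comp_apply]
        simp only [Bool.false_eq_true, if_false]
        congr 1
        funext j
        by_cases hj : j = i
        · subst hj; simp
        · simp [hj]
  refine Eq.mp (congrArg (· ∈ cubes X (s + 1)) ?_) (key (Finset.univ.erase (Fin.last s)) (by simp))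
  funext ω
  unfold structConfig
  split_ifs with h1 h2 h2
  · rw [eq_topEdge h1, h2]
  · rw [eq_topEdge h1]
    simp at h2
    rw [h2]
  · congr 1
    funext j
    by_cases hj : j = Fin.last s
    · subst hj; simp [h2]
    · simp [topEdge, hj]
  · congr 1
    funext j
    by_cases hj : j = Fin.last s
    · subst hj; simpa using h2
    · simp [topEdge, hj]

/-- If applying `g` at both ends of one fixed edge preserves cubes, then so does applying `g` at
both ends of an arbitrary edge. -/
lemma edge_mem_cubes {n : ℕ} {g : X → X}
    (hg : ∀ c ∈ cubes X (n + 1), (fun ω => if ∀ i, i ≠ Fin.last n → ω i = true then g (c ω)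
      else c ω) ∈ cubes X (n + 1))
    {c : DCube (n + 1) → X} (hc : c ∈ cubes X (n + 1)) (ω₀ : DCube (n + 1)) (j : Fin (n + 1)) :
    (fun ω => if ∀ i, i ≠ j → ω i = ω₀ i then g (c ω) else c ω) ∈ cubes X (n + 1) := by
  let e := Equiv.swap j (Fin.last n)
  let σ : DCube (n + 1) → DCube (n + 1) := fun ω i => ω (e i) ^^ !(ω₀ i)
  let τ : DCube (n + 1) → DCube (n + 1) := fun ω i => ω (e i) ^^ !(ω₀ (e i))
  have hσ : IsDCubeMorphism σ := isDCubeMorphism_permXor e fun i => !(ω₀ i)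
  have hτ : IsDCubeMorphism τ := isDCubeMorphism_permXor e fun i => !(ω₀ (e i))
  have hστ : ∀ ω, σ (τ ω) = ω := fun ω => funext fun i => by simp [σ, τ, e]
  refine Eq.mp (congrArg (· ∈ cubes X (n + 1)) ?_)
    (comp_mem_cubes hτ (hg _ (comp_mem_cubes hσ hc)))
  funext ω
  have hiff : (∀ i, i ≠ Fin.last n → τ ω i = true) ↔ ∀ i, i ≠ j → ω i = ω₀ i := by
    constructor
    · intro h i hi
      have h1 := h (e i) fun h => hi (by simpa [e] using congrArg e h)
      simpa [τ, e] using h1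
    · intro h i hi
      have h1 := h (e i) fun h => hi (by simpa [e] using congrArg e h)
      simp [τ, h1]
  simp only [Function.comp_apply, hστ, hiff]

end Cubes

/-! ### The structure relation -/

section Relation

variable {X Y : Type*} [MetricSpace X] [Cubespace X] {f : X → Y} {s : ℕ}

lemma HasRelUniqueness.succ {k : ℕ} (h : HasRelUniqueness f k) : HasRelUniqueness f (k + 1) := by
  intro c hc c' hc' hf hcc
  funext ω
  by_cases hω : ω = DCube.one (k + 1)
  · have hδ := isDCubeMorphism_insertNth (0 : Fin (k + 1)) true
    have h1 : DCube.one (k + 1) = Fin.insertNth (α := fun _ => Bool) 0 true (DCube.one k) := by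
      funext i
      refine Fin.cases ?_ (fun i => ?_) i <;> simp [DCube.one]
    have h2 := h _ (comp_mem_cubes hδ hc) _ (comp_mem_cubes hδ hc')
      (by rw [← Function.comp_assoc, hf, Function.comp_assoc]) fun η hη => hcc _ fun he => hη <| by
        rw [h1] at he
        exact Fin.insertNth_right_injective (α := fun _ => Bool) _ he
    rw [hω, h1]
    exact congrFun h2 _
  · exact hcc ω hω

lemma HasRelUniqueness.mono {k l : ℕ} (h : HasRelUniqueness f k) (hkl : k ≤ l) :
    HasRelUniqueness f l := by
  induction hkl with
  | refl => exact h
  | step _ ih => exact ih.succ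

lemma structureRel_iff (hXe : IsErgodicCubespace X) (hXg : HasGlueing X) (p q : FibrePairs f) :
    structureRel f s p q ↔ structConfig s p.1.1 p.1.2 q.1.1 q.1.2 ∈ cubes X (s + 1) := by
  have hone : (fun i : Fin s => topEdge s true i.castSucc) = DCube.one s ∧
      (fun i : Fin s => topEdge s false i.castSucc) = DCube.one s := by
    constructor <;> funext i <;> simp [topEdge, DCube.one, Fin.castSucc_ne_last]
  have hall : ∀ ω : DCube (s + 1), (fun i : Fin s => ω i.castSucc) = DCube.one s ↔
      ∀ i, i ≠ Fin.last s → ω i = true := by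
    intro ω
    constructor
    · intro h i hi
      obtain ⟨m, rfl⟩ := Fin.exists_castSucc_eq.2 hi
      exact congrFun h m
    · intro h
      funext i
      exact h _ (Fin.castSucc_ne_last i)
  constructor
  · rintro ⟨h, h', c, hc, c', hc', h1, h1', hcc⟩
    have key := hXg.structConfig_mem (c := unfoldEdges c) (c' := unfoldEdges c') hc hc'
      fun ω hω => by
        have := hcc (fun i => ω i.castSucc) (fun e => hω ((hall ω).1 e))
        simp only [unfoldEdges, this]
    simpa [unfoldEdges, hone.1, hone.2, h1, h1'] using key
  · intro h
    have he : ∀ p : X × X, edgeConfig p ∈ cubes X 1 := fun p => by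
      rw [hXe]; trivial
    refine ⟨he _, he _, fun _ => ⟨_, he _⟩, ?_,
      fun ω => if ω = DCube.one s then ⟨_, he _⟩ else ⟨_, he _⟩, ?_, rfl, if_pos rfl,
      fun ω hω => (if_neg hω).symm⟩
    · exact const_mem_cubes (X := EdgeSpace X) s _
    · change unfoldEdges _ ∈ cubes X (s + 1)
      refine Eq.mp (congrArg (· ∈ cubes X (s + 1)) ?_) h
      funext ω
      simp only [structConfig, unfoldEdges, hall]
      split_ifs <;> rfl

lemma structConfig_symm {x x' y y' : X} (h : structConfig s x x' y y' ∈ cubes X (s + 1)) :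
    structConfig s y y' x x' ∈ cubes X (s + 1) := by
  refine Eq.mp (congrArg (· ∈ cubes X (s + 1)) ?_)
    (comp_mem_cubes (isDCubeMorphism_permXor (fun i => i) fun i => decide (i = Fin.last s)) h)
  funext ω
  have hall : (∀ i, i ≠ Fin.last s → (ω i ^^ decide (i = Fin.last s)) = true) ↔
      ∀ i, i ≠ Fin.last s → ω i = true := by
    refine forall₂_congr fun i hi => ?_
    simp [hi]
  simp only [Function.comp_apply, structConfig, hall]
  cases ω (Fin.last s) <;> simp

end Relation

/-- The standing hypotheses on `f`, in the form in which they are used: its source `X` is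
ergodic and has the glueing property, `f` is a fibration with `(s+1)`-uniqueness, and all
configurations of dimension at most `s` above a cube are cubes. -/
structure IsDegreeFibration {X Y : Type*} [MetricSpace X] [Cubespace X] [MetricSpace Y]
    [Cubespace Y] (f : X → Y) (s : ℕ) : Prop where
  ergodic : IsErgodicCubespace X
  glueing : HasGlueing X
  fib : IsFibration f
  uniq : HasRelUniqueness f (s + 1)
  mem_cubes_of_le : ∀ l ≤ s, ∀ c : DCube l → X, f ∘ c ∈ cubes Y l → c ∈ cubes X l

section Structure

variable {X Y : Type*} [MetricSpace X] [Cubespace X] [MetricSpace Y] [Cubespace Y]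
  {f : X → Y} {s : ℕ}

lemma isDegreeFibration (hXe : IsErgodicCubespace X) (hXg : HasGlueing X) (hf : IsFibration f)
    (hfd : RelDegreeAtMost f s) (hfe : IsRelErgodic f s) : IsDegreeFibration f s where
  ergodic := hXe
  glueing := hXg
  fib := hf
  uniq := by
    obtain ⟨k, hk, h⟩ := hfd
    exact h.mono hk
  mem_cubes_of_le l hl c hc := by
    rcases Nat.eq_zero_or_pos l with rfl | h
    · exact mem_cubes_zero c
    · exact hfe l h hl c hc

lemma IsFibration.surjective (hf : IsFibration f) : Function.Surjective f := by
  intro y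
  obtain ⟨c, -, -, h⟩ := hf.lift 0 (fun _ => y) (const_mem_cubes 0 y)
    (fun ω => (ω.2 (Subsingleton.elim _ _)).elim) trivial
    (fun ω => (ω.2 (Subsingleton.elim _ _)).elim)
  exact ⟨_, h⟩

namespace IsDegreeFibration

variable (H : IsDegreeFibration f s)

include H

lemma structConfig_refl (x y : X) : structConfig s x x y y ∈ cubes X (s + 1) := by
  have h : edgeConfig (x, y) ∈ cubes X 1 := by rw [H.ergodic]; trivial
  refine Eq.mp (congrArg (· ∈ cubes X (s + 1)) ?_)
    (comp_mem_cubes (isDCubeMorphism_perm fun _ : Fin 1 => Fin.last s) h)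
  funext ω
  simp [structConfig, edgeConfig]

lemma structConfig_self {x x' : X} (h : f x = f x') :
    structConfig s x x' x x' ∈ cubes X (s + 1) := by
  have h1 : (fun ω : DCube s => if ω = DCube.one s then x' else x) ∈ cubes X s := by
    refine H.mem_cubes_of_le s le_rfl _
      (Eq.mp (congrArg (· ∈ cubes Y s) ?_) (const_mem_cubes s (f x)))
    funext ω
    simp only [Function.comp_apply]
    split_ifs <;> simp [h]
  refine Eq.mp (congrArg (· ∈ cubes X (s + 1)) ?_)
    (comp_mem_cubes (isDCubeMorphism_perm Fin.castSucc) h1)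
  funext ω
  have hall : (fun i : Fin s => ω i.castSucc) = DCube.one s ↔
      ∀ i, i ≠ Fin.last s → ω i = true := by
    constructor
    · intro h i hi
      obtain ⟨m, rfl⟩ := Fin.exists_castSucc_eq.2 hi
      exact congrFun h m
    · intro h
      funext i
      exact h _ (Fin.castSucc_ne_last i)
  simp [structConfig, hall]

lemma structConfig_trans {x x' y y' z z' : X}
    (h : structConfig s x x' y y' ∈ cubes X (s + 1))
    (h' : structConfig s y y' z z' ∈ cubes X (s + 1)) :
    structConfig s x x' z z' ∈ cubes X (s + 1) := by
  have hall : ∀ (ω : DCube (s + 1)) (b : Bool),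
      (∀ i, i ≠ Fin.last s → Function.update ω (Fin.last s) b i = true) ↔
      ∀ i, i ≠ Fin.last s → ω i = true := by
    intro ω b
    refine forall₂_congr fun i hi => ?_
    simp [hi]
  refine Eq.mp (congrArg (· ∈ cubes X (s + 1)) ?_) (H.glueing.glue h h' (Fin.last s) fun ω => ?_)
  · funext ω
    simp only [structConfig]
    split_ifs <;> rfl
  · simp only [structConfig, hall]
    simp

/-- The relation is also symmetric with respect to reversing both pairs. -/
lemma structConfig_reverse {x x' y y' : X} (h : structConfig s x x' y y' ∈ cubes X (s + 1)) :
    structConfig s x' x y' y ∈ cubes X (s + 1) := by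
  have := H.glueing.structConfig_mem h (H.structConfig_refl x y) fun ω hω => by
    simp only [structConfig, if_neg hω]
  simpa using this

lemma structConfig_concat {x x' x'' y y' y'' : X}
    (h : structConfig s x x' y y' ∈ cubes X (s + 1))
    (h' : structConfig s x' x'' y' y'' ∈ cubes X (s + 1)) :
    structConfig s x x'' y y'' ∈ cubes X (s + 1) := by
  have := H.glueing.structConfig_mem (H.structConfig_reverse h) h' fun ω hω => by
    simp only [structConfig, if_neg hω]
  simpa using this

/-- The value of an `(s+1)`-cube at `(1, …, 1, 0)` may be changed within its fibre, provided that
the value at `(1, …, 1)` is changed accordingly: the lower faces of the changed configuration are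
cubes, one of them by relative ergodicity and the others because they are unchanged. -/
lemma exists_changeEdge {c : DCube (s + 1) → X} (hc : c ∈ cubes X (s + 1)) {x' : X}
    (hx' : f (c (topEdge s false)) = f x') :
    ∃ y', f (c (topEdge s true)) = f y' ∧
      (fun ω => if ∀ i, i ≠ Fin.last s → ω i = true then
        (if ω (Fin.last s) = true then y' else x') else c ω) ∈ cubes X (s + 1) := by
  classical
  let c₁ : DCube (s + 1) → X := fun ω => if ω = topEdge s false then x' else c ω
  have hfc₁ : f ∘ c₁ = f ∘ c := by
    funext ω
    simp only [c₁, Function.comp_apply]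
    split_ifs with h
    · rw [h, hx']
    · rfl
  obtain ⟨c', hc', hcc', h1⟩ := H.fib.lift (s + 1) (f ∘ c) (H.fib.map_cubes _ c hc)
    (fun ω => c₁ ω.1) (fun i => by
      by_cases hi : i = Fin.last s
      · refine H.mem_cubes_of_le s le_rfl _ ?_
        have := comp_mem_cubes (isDCubeMorphism_insertNth i false) (H.fib.map_cubes _ c hc)
        rwa [← hfc₁] at this
      · refine Eq.mp (congrArg (· ∈ cubes X s) ?_)
          (comp_mem_cubes (isDCubeMorphism_insertNth i false) hc)
        funext ω
        refine (if_neg fun h => ?_).symm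
        have := congrFun h i
        simp [lowerFaceVertex, topEdge, hi] at this)
    (fun ω => congrFun hfc₁ ω.1)
  refine ⟨c' (DCube.one _), by rw [h1, topEdge_true]; rfl,
    Eq.mp (congrArg (· ∈ cubes X (s + 1)) ?_) hc'⟩
  funext ω
  split_ifs with h2 h3
  · rw [eq_topEdge h2, h3, topEdge_true]
  · have h4 : ω = topEdge s false := by
      rw [eq_topEdge h2, (by simpa using h3 : ω (Fin.last s) = false)]
    have h5 := hcc' ⟨ω, fun h => h3 (by rw [h]; rfl)⟩
    rw [h5]
    exact if_pos h4
  · have h5 := hcc' ⟨ω, fun h => h2 fun i _ => by rw [h]; rfl⟩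
    rw [h5]
    exact if_neg fun h : ω = _ => h2 (by rw [h]; exact topEdge_cond s false)

lemma structConfig_unique {x x' y y' y'' : X} (h : structConfig s x x' y y' ∈ cubes X (s + 1))
    (h' : structConfig s x x' y y'' ∈ cubes X (s + 1)) (hy : f y' = f y'') : y' = y'' := by
  have := H.uniq _ h _ h'
    (by
      funext ω
      simp only [Function.comp_apply, structConfig]
      split_ifs <;> simp [hy])
    (fun ω hω => by
      simp only [structConfig]
      split_ifs with h1 h2
      · exact absurd (by rw [eq_topEdge h1, h2, topEdge_true]) hω
      all_goals rfl)
  simpa using congrFun this (topEdge s true)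

lemma exists_structConfig {x x' : X} (h : f x = f x') (y : X) :
    ∃ y', f y = f y' ∧ structConfig s x x' y y' ∈ cubes X (s + 1) := by
  obtain ⟨y', h1, h2⟩ := H.exists_changeEdge (H.structConfig_refl x y) (x' := x')
    (by simpa using h)
  refine ⟨y', by simpa using h1, Eq.mp (congrArg (· ∈ cubes X (s + 1)) ?_) h2⟩
  funext ω
  simp only [structConfig]
  split_ifs <;> rfl

/-- Related pairs may be exchanged on an edge of an `(s+1)`-cube. -/
lemma changeEdge_mem {c : DCube (s + 1) → X} (hc : c ∈ cubes X (s + 1)) {x' y' : X}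
    (hx' : f (c (topEdge s false)) = f x') (hy' : f (c (topEdge s true)) = f y')
    (h : structConfig s (c (topEdge s false)) x' (c (topEdge s true)) y' ∈ cubes X (s + 1)) :
    (fun ω => if ∀ i, i ≠ Fin.last s → ω i = true then
        (if ω (Fin.last s) = true then y' else x') else c ω) ∈ cubes X (s + 1) := by
  obtain ⟨y'', h1, h2⟩ := H.exists_changeEdge hc hx'
  have h3 := H.glueing.structConfig_mem hc h2 fun ω hω => (if_neg hω).symm
  rw [if_pos (topEdge_cond s _), if_pos (topEdge_cond s _)] at h3
  have h4 := H.structConfig_unique h (by simpa using h3) (hy'.symm.trans h1)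
  rwa [h4]

lemma equivalence : Equivalence (structureRel f s) where
  refl p := (structureRel_iff H.ergodic H.glueing _ _).2 (H.structConfig_self p.2)
  symm h := by
    rw [structureRel_iff H.ergodic H.glueing] at h ⊢
    exact structConfig_symm h
  trans h h' := by
    rw [structureRel_iff H.ergodic H.glueing] at h h' ⊢
    exact H.structConfig_trans h h'

lemma mk_eq_mk_iff {x x' y y' : X} {h : f x = f x'} {h' : f y = f y'} :
    StructureGroup.mk f s x x' h = StructureGroup.mk f s y y' h' ↔
      structConfig s x x' y y' ∈ cubes X (s + 1) :=
  (Equivalence.quot_mk_eq_iff H.equivalence _ _).trans (structureRel_iff H.ergodic H.glueing _ _)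

lemma exists_mk_eq (a : StructureGroup f s) (x : X) :
    ∃ x', ∃ h : f x = f x', StructureGroup.mk f s x x' h = a := by
  induction a using Quot.ind with
  | mk p =>
    obtain ⟨x', h, h1⟩ := H.exists_structConfig p.2 x
    exact ⟨x', h, (H.mk_eq_mk_iff.2 h1).symm⟩

end IsDegreeFibration

end Structure

/-! ### The structure group and its action -/

section Action

variable {X Y : Type*} [MetricSpace X] [Cubespace X] [MetricSpace Y] [Cubespace Y]
  {f : X → Y} {s : ℕ}

namespace IsDegreeFibration

variable (H : IsDegreeFibration f s)

/-- The action of the structure group: `act a x` is the end point of the unique representative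
of `a` starting at `x`. -/
noncomputable def act (a : StructureGroup f s) (x : X) : X :=
  (H.exists_mk_eq a x).choose

lemma map_act (a : StructureGroup f s) (x : X) : f x = f (H.act a x) :=
  (H.exists_mk_eq a x).choose_spec.choose

lemma mk_act (a : StructureGroup f s) (x : X) :
    StructureGroup.mk f s x (H.act a x) (H.map_act a x) = a :=
  (H.exists_mk_eq a x).choose_spec.choose_spec

lemma act_mk_eq_iff {x x' y y' : X} (h : f x = f x') (h' : f y = f y') :
    H.act (StructureGroup.mk f s x x' h) y = y' ↔ structConfig s x x' y y' ∈ cubes X (s + 1) := by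
  have h1 := H.mk_eq_mk_iff.1 (H.mk_act (StructureGroup.mk f s x x' h) y).symm
  refine ⟨fun e => ?_, fun h2 => H.structConfig_unique h1 h2 ((H.map_act _ _).symm.trans h')⟩
  rwa [e] at h1

lemma act_mk {x x' : X} (h : f x = f x') : H.act (StructureGroup.mk f s x x' h) x = x' :=
  (H.act_mk_eq_iff h h).2 (H.structConfig_self h)

lemma act_injective (x : X) : Function.Injective fun a => H.act a x := by
  intro a b hab
  have hab : H.act a x = H.act b x := hab
  rw [← H.mk_act a x, ← H.mk_act b x]
  congr 1

lemma structConfig_act (a : StructureGroup f s) (x y : X) :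
    structConfig s x (H.act a x) y (H.act a y) ∈ cubes X (s + 1) :=
  H.mk_eq_mk_iff.1 ((H.mk_act a x).trans (H.mk_act a y).symm)

/-- Applying an element of the structure group at both ends of an edge of an `(s+1)`-cube gives
a cube. -/
lemma act_edge_mem (a : StructureGroup f s) {c : DCube (s + 1) → X} (hc : c ∈ cubes X (s + 1))
    (ω₀ : DCube (s + 1)) (j : Fin (s + 1)) :
    (fun ω => if ∀ i, i ≠ j → ω i = ω₀ i then H.act a (c ω) else c ω) ∈ cubes X (s + 1) := by
  refine edge_mem_cubes (fun c hc => ?_) hc ω₀ j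
  refine Eq.mp (congrArg (· ∈ cubes X (s + 1)) ?_)
    (H.changeEdge_mem hc (H.map_act a _) (H.map_act a _) (H.structConfig_act a _ _))
  funext ω
  split_ifs with h1 h2
  · rw [eq_topEdge h1, h2]
  · rw [eq_topEdge h1, (by simpa using h2 : ω (Fin.last s) = false)]
  · rfl

/-- For `s ≥ 1`, apply `a` and `b` to two edges of an `(s+1)`-cube that meet in a single vertex. The
order matters only at that vertex, where it does not matter by uniqueness. -/
lemma act_comm (a b : StructureGroup f s) (x : X) :
    H.act a (H.act b x) = H.act b (H.act a x) := by
  have hfab : f (H.act a (H.act b x)) = f (H.act b (H.act a x)) := by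
    simp only [← H.map_act]
  obtain rfl | ⟨n, rfl⟩ : s = 0 ∨ ∃ n, s = n + 1 := by cases s <;> simp
  · -- For `s = 0` any two points form a `1`-cube, so `f` is injective and the group is trivial.
    have hsub : ∀ a : StructureGroup f 0, H.act a x = x := fun a => by
      have h1 : structConfig 0 x x x (H.act a x) ∈ cubes X 1 := by
        have : edgeConfig (x, H.act a x) ∈ cubes X 1 := by rw [H.ergodic]; trivial
        refine Eq.mp (congrArg (· ∈ cubes X 1) ?_) this
        funext ω
        simp [structConfig, edgeConfig]
      exact H.structConfig_unique h1 (H.structConfig_refl x x) (H.map_act a x).symm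
    have hid : a = b := H.act_injective x ((hsub a).trans (hsub b).symm)
    rw [hid]
  · let o : DCube (n + 1 + 1) := DCube.one _
    have h0 := const_mem_cubes (n + 1 + 1) x
    have h1 := H.act_edge_mem b (H.act_edge_mem a h0 o 0) o (Fin.last _)
    have h2 := H.act_edge_mem a (H.act_edge_mem b h0 o (Fin.last _)) o 0
    have h3 := H.uniq _ h1 _ h2
      (by
        funext ω
        simp only [Function.comp_apply]
        split_ifs <;> simp only [← H.map_act])
      fun ω hω => by
        split_ifs with h4 h5
        · refine absurd (funext fun i => ?_) hω
          by_cases hi : i = 0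
          · exact h4 i (by rw [hi]; exact (Fin.last_pos).ne)
          · exact h5 i hi
        all_goals rfl
    have h4 := congrFun h3 o
    simpa using h4.symm

lemma act_mk_trans {x y z : X} (hxy : f x = f y) (hyz : f y = f z) (w : X) :
    H.act (StructureGroup.mk f s y z hyz) (H.act (StructureGroup.mk f s x y hxy) w) =
      H.act (StructureGroup.mk f s x z (hxy.trans hyz)) w := by
  symm
  rw [H.act_mk_eq_iff _ ((H.map_act _ _).trans (H.map_act _ _))]
  exact H.structConfig_concat ((H.act_mk_eq_iff hxy (H.map_act _ _)).1 rfl)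
    ((H.act_mk_eq_iff hyz (H.map_act _ _)).1 rfl)

variable [Nonempty X]

/-- The sum of two classes, by concatenating representatives starting at a base point. -/
noncomputable def addClass (a b : StructureGroup f s) : StructureGroup f s :=
  StructureGroup.mk f s (Classical.arbitrary X) (H.act b (H.act a (Classical.arbitrary X)))
    ((H.map_act _ _).trans (H.map_act _ _))

/-- The class of the trivial pairs `[x, x]`. -/
noncomputable def zeroClass (_ : IsDegreeFibration f s) : StructureGroup f s :=
  StructureGroup.mk f s (Classical.arbitrary X) (Classical.arbitrary X) rfl

/-- The class of the reversed pairs. -/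
noncomputable def negClass (a : StructureGroup f s) : StructureGroup f s :=
  StructureGroup.mk f s (H.act a (Classical.arbitrary X)) (Classical.arbitrary X)
    (H.map_act _ _).symm

lemma act_addClass (a b : StructureGroup f s) (x : X) :
    H.act (H.addClass a b) x = H.act b (H.act a x) := by
  have h := H.act_mk_trans (H.map_act a (Classical.arbitrary X))
    (H.map_act b (H.act a (Classical.arbitrary X))) x
  rw [H.mk_act, H.mk_act] at h
  exact h.symm

lemma act_zeroClass (x : X) : H.act H.zeroClass x = x :=
  (H.act_mk_eq_iff rfl rfl).2 (H.structConfig_refl _ _)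

lemma act_negClass (a : StructureGroup f s) (x : X) : H.act (H.negClass a) (H.act a x) = x := by
  have h := H.act_mk_trans (H.map_act a (Classical.arbitrary X)) (H.map_act a _).symm x
  rw [H.mk_act] at h
  exact h.trans (H.act_zeroClass x)

/-- The structure group as an abelian group. -/
@[reducible] noncomputable def addCommGroup : AddCommGroup (StructureGroup f s) where
  add := H.addClass
  zero := H.zeroClass
  neg := H.negClass
  add_assoc a b c := H.act_injective (Classical.arbitrary X) <| by
    change H.act (H.addClass (H.addClass a b) c) _ = H.act (H.addClass a (H.addClass b c)) _
    simp only [act_addClass]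
  zero_add a := H.act_injective (Classical.arbitrary X) <| by
    change H.act (H.addClass H.zeroClass a) _ = H.act a _
    simp only [act_addClass, act_zeroClass]
  add_zero a := H.act_injective (Classical.arbitrary X) <| by
    change H.act (H.addClass a H.zeroClass) _ = H.act a _
    simp only [act_addClass, act_zeroClass]
  neg_add_cancel a := H.act_injective (Classical.arbitrary X) <| by
    change H.act (H.addClass (H.negClass a) a) _ = H.act H.zeroClass _
    rw [act_addClass, act_zeroClass, act_comm, act_negClass]
  add_comm a b := H.act_injective (Classical.arbitrary X) <| by
    change H.act (H.addClass a b) _ = H.act (H.addClass b a) _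
    rw [act_addClass, act_addClass, act_comm]
  nsmul := @nsmulRec _ ⟨H.zeroClass⟩ ⟨H.addClass⟩
  zsmul := @zsmulRec _ ⟨H.zeroClass⟩ ⟨H.addClass⟩ ⟨H.negClass⟩
    (@nsmulRec _ ⟨H.zeroClass⟩ ⟨H.addClass⟩)

/-- The action of the structure group on `X`. -/
@[reducible] noncomputable def addAction :
    letI := H.addCommGroup
    AddAction (StructureGroup f s) X :=
  letI := H.addCommGroup
  { vadd := H.act
    zero_vadd := H.act_zeroClass
    add_vadd := fun a b x => by
      change H.act (H.addClass a b) x = H.act a (H.act b x)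
      rw [act_addClass, act_comm] }

lemma mk_add_mk {x y z : X} (hxy : f x = f y) (hyz : f y = f z) :
    H.addClass (StructureGroup.mk f s x y hxy) (StructureGroup.mk f s y z hyz) =
      StructureGroup.mk f s x z (hxy.trans hyz) :=
  H.act_injective x (by
    change H.act _ x = H.act _ x
    rw [act_addClass, H.act_mk_trans hxy hyz])

end IsDegreeFibration

end Action

/-! ### The topology of the structure group -/

section Topology

/-- The closed graph theorem for maps into a compact space. -/
lemma continuous_of_isClosed_graph {α β : Type*} [TopologicalSpace α] [TopologicalSpace β]
    [CompactSpace β] {g : α → β} (h : IsClosed {p : α × β | g p.1 = p.2}) : Continuous g := by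
  refine continuous_iff_isClosed.2 fun C hC => ?_
  have h1 := isClosedMap_fst_of_compactSpace _ (h.inter (hC.preimage continuous_snd))
  refine Eq.mp (congrArg IsClosed ?_) h1
  ext a
  constructor
  · rintro ⟨p, ⟨hp, hpC⟩, rfl⟩
    have hp : g p.1 = p.2 := hp
    change g p.1 ∈ C
    rw [hp]
    exact hpC
  · exact fun ha => ⟨(a, g a), ⟨rfl, ha⟩, rfl⟩

lemma continuous_structConfig {X : Type*} [TopologicalSpace X] (s : ℕ) :
    Continuous fun p : X × X × X × X => structConfig s p.1 p.2.1 p.2.2.1 p.2.2.2 := by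
  refine continuous_pi fun ω => ?_
  unfold structConfig
  split_ifs <;> fun_prop

variable {X Y : Type*} [MetricSpace X] [Cubespace X] [CompactSpace X]
  [MetricSpace Y] [Cubespace Y] {f : X → Y} {s : ℕ}

namespace IsDegreeFibration

variable (H : IsDegreeFibration f s)

include H

lemma continuous_act_fibrePairs :
    Continuous fun q : FibrePairs f × X =>
      H.act (StructureGroup.mk f s q.1.1.1 q.1.1.2 q.1.2) q.2 := by
  have hf : Continuous f := H.fib.continuous
  refine continuous_of_isClosed_graph ?_
  have h1 : {p : (FibrePairs f × X) × X |
      H.act (StructureGroup.mk f s p.1.1.1.1 p.1.1.1.2 p.1.1.2) p.1.2 = p.2} =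
      {p | f p.1.2 = f p.2} ∩ {p | structConfig s p.1.1.1.1 p.1.1.1.2 p.1.2 p.2 ∈
        cubes X (s + 1)} := by
    ext p
    constructor
    · intro h
      have h : H.act (StructureGroup.mk f s p.1.1.1.1 p.1.1.1.2 p.1.1.2) p.1.2 = p.2 := h
      have h2 : f p.1.2 = f p.2 := by rw [← h]; exact H.map_act _ _
      exact ⟨h2, (H.act_mk_eq_iff _ h2).1 h⟩
    · rintro ⟨h2, h⟩
      exact (H.act_mk_eq_iff _ h2).2 h
  rw [h1]
  refine (isClosed_eq (by fun_prop) (by fun_prop)).inter ((isClosed_cubes (s + 1)).preimage ?_)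
  exact (continuous_structConfig s).comp (f := fun p : (FibrePairs f × X) × X =>
    (p.1.1.1.1, p.1.1.1.2, p.1.2, p.2)) (by fun_prop)

lemma compactSpace_structureGroup : CompactSpace (StructureGroup f s) := by
  have hf : Continuous f := H.fib.continuous
  have : CompactSpace (FibrePairs f) := isCompact_iff_compactSpace.1
    (isClosed_eq (f := fun p : X × X => f p.1) (g := fun p => f p.2)
      (by fun_prop) (by fun_prop)).isCompact
  infer_instance

/-- The structure group is homeomorphic to every fibre of `f`, by its action on a point of the
fibre. -/
noncomputable def homeomorphFibre (x₀ : X) : StructureGroup f s ≃ₜ {y : X // f x₀ = f y} where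
  toFun a := ⟨H.act a x₀, H.map_act a x₀⟩
  invFun y := StructureGroup.mk f s x₀ y.1 y.2
  left_inv a := H.mk_act a x₀
  right_inv y := Subtype.ext (H.act_mk y.2)
  continuous_toFun := by
    refine Continuous.subtype_mk (isQuotientMap_quot_mk.continuous_iff.2 ?_) _
    exact H.continuous_act_fibrePairs.comp (f := fun p : FibrePairs f => (p, x₀)) (by fun_prop)
  continuous_invFun := by
    exact continuous_quot_mk.comp (f := fun y : {y : X // f x₀ = f y} =>
      (⟨(x₀, y.1), y.2⟩ : FibrePairs f)) (by fun_prop)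

lemma continuous_act [Nonempty X] :
    Continuous fun q : StructureGroup f s × X => H.act q.1 q.2 := by
  let x₀ : X := Classical.arbitrary X
  have h1 : Continuous fun q : StructureGroup f s × X => (H.homeomorphFibre x₀ q.1).1 :=
    continuous_subtype_val.comp ((H.homeomorphFibre x₀).continuous.comp continuous_fst)
  have h := H.continuous_act_fibrePairs.comp (f := fun q : StructureGroup f s × X =>
    ((⟨(x₀, (H.homeomorphFibre x₀ q.1).1), (H.homeomorphFibre x₀ q.1).2⟩ : FibrePairs f), q.2))
    ((Continuous.subtype_mk (continuous_const.prodMk h1) _).prodMk continuous_snd)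
  refine h.congr fun q => ?_
  exact congrArg (H.act · q.2) (H.mk_act q.1 x₀)

lemma metrizableSpace_structureGroup [Nonempty X] :
    TopologicalSpace.MetrizableSpace (StructureGroup f s) :=
  (H.homeomorphFibre (Classical.arbitrary X)).isEmbedding.metrizableSpace

lemma continuous_addClass [Nonempty X] :
    Continuous fun q : StructureGroup f s × StructureGroup f s => H.addClass q.1 q.2 := by
  have hact := H.continuous_act
  exact continuous_quot_mk.comp (f := fun q : StructureGroup f s × StructureGroup f s =>
    (⟨(Classical.arbitrary X, H.act q.2 (H.act q.1 (Classical.arbitrary X))),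
      (H.map_act _ _).trans (H.map_act _ _)⟩ : FibrePairs f))
    (Continuous.subtype_mk (continuous_const.prodMk (hact.comp (continuous_snd.prodMk
      (hact.comp (continuous_fst.prodMk continuous_const))))) _)

lemma continuous_negClass [Nonempty X] : Continuous H.negClass := by
  have hact := H.continuous_act
  exact continuous_quot_mk.comp (f := fun a : StructureGroup f s =>
    (⟨(H.act a (Classical.arbitrary X), Classical.arbitrary X), (H.map_act _ _).symm⟩ :
      FibrePairs f))
    (Continuous.subtype_mk ((hact.comp (continuous_id.prodMk continuous_const)).prodMk
      continuous_const) _)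

end IsDegreeFibration

end Topology

/-! ### Host–Kra cubes and alternating sums -/

section AltSum

lemma IsDCubeMorphism.comp {k l m : ℕ} {σ : DCube l → DCube m} {ρ : DCube k → DCube l}
    (hσ : IsDCubeMorphism σ) (hρ : IsDCubeMorphism ρ) : IsDCubeMorphism (σ ∘ ρ) := by
  intro i
  simp only [Function.comp_apply]
  rcases hσ i with h | h | ⟨j, h⟩ | ⟨j, h⟩
  · exact Or.inl fun x => h _
  · exact Or.inr (Or.inl fun x => h _)
  · rcases hρ j with h' | h' | ⟨m, h'⟩ | ⟨m, h'⟩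
    · exact Or.inl fun x => by rw [h, h']
    · exact Or.inr (Or.inl fun x => by rw [h, h'])
    · exact Or.inr (Or.inr (Or.inl ⟨m, fun x => by rw [h, h']⟩))
    · exact Or.inr (Or.inr (Or.inr ⟨m, fun x => by rw [h, h']⟩))
  · rcases hρ j with h' | h' | ⟨m, h'⟩ | ⟨m, h'⟩
    · exact Or.inr (Or.inl fun x => by simp [h, h'])
    · exact Or.inl fun x => by simp [h, h']
    · exact Or.inr (Or.inr (Or.inr ⟨m, fun x => by rw [h, h']⟩))
    · exact Or.inr (Or.inr (Or.inl ⟨m, fun x => by simp [h, h']⟩))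

lemma isDCubeMorphism_snoc {n : ℕ} (b : Bool) :
    IsDCubeMorphism (fun ω : DCube n => (Fin.snoc (α := fun _ => Bool) ω b : DCube (n + 1))) := by
  intro i
  refine Fin.lastCases ?_ (fun i => ?_) i
  · cases b
    · exact Or.inl fun x => by simp
    · exact Or.inr (Or.inl fun x => by simp)
  · exact Or.inr (Or.inr (Or.inl ⟨i, fun x => by simp⟩))

lemma IsDCubeMorphism.snoc_last {k l : ℕ} {ρ : DCube k → DCube l} (hρ : IsDCubeMorphism ρ) :
    IsDCubeMorphism (fun ω : DCube (k + 1) => (Fin.snoc (α := fun _ => Bool)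
      (ρ fun i => ω i.castSucc) (ω (Fin.last k)) : DCube (l + 1))) := by
  intro i
  refine Fin.lastCases ?_ (fun i => ?_) i
  · exact Or.inr (Or.inr (Or.inl ⟨Fin.last k, fun x => by simp⟩))
  · rcases hρ i with h | h | ⟨j, h⟩ | ⟨j, h⟩
    · exact Or.inl fun x => by simp [h]
    · exact Or.inr (Or.inl fun x => by simp [h])
    · exact Or.inr (Or.inr (Or.inl ⟨j.castSucc, fun x => by simp [h]⟩))
    · exact Or.inr (Or.inr (Or.inr ⟨j.castSucc, fun x => by simp [h]⟩))

variable {A : Type*} [AddCommGroup A]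

/-- Restriction of configurations to a face in the last coordinate. -/
def restrictLast (A : Type*) [AddCommGroup A] (n : ℕ) (b : Bool) :
    (DCube (n + 1) → A) →+ (DCube n → A) where
  toFun g ω := g (Fin.snoc (α := fun _ => Bool) ω b)
  map_zero' := rfl
  map_add' _ _ := rfl

/-- The alternating sum of a configuration over the vertices of the discrete cube, with sign `+1` at
`(1, …, 1)`. -/
def altSum (A : Type*) [AddCommGroup A] : (n : ℕ) → (DCube n → A) →+ A
  | 0 => Pi.evalAddMonoidHom (fun _ => A) fun i => i.elim0
  | n + 1 => (altSum A n).comp (restrictLast A n true) - (altSum A n).comp (restrictLast A n false)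

lemma altSum_succ (n : ℕ) (g : DCube (n + 1) → A) :
    altSum A (n + 1) g = altSum A n (fun ω => g (Fin.snoc (α := fun _ => Bool) ω true)) -
      altSum A n (fun ω => g (Fin.snoc (α := fun _ => Bool) ω false)) :=
  rfl

/-- The alternating sum of a configuration not depending on one of the coordinates vanishes. -/
lemma altSum_eq_zero {n : ℕ} (g : DCube n → A) (j : Fin n)
    (h : ∀ ω b, g (Function.update ω j b) = g ω) : altSum A n g = 0 := by
  induction n with
  | zero => exact j.elim0
  | succ n ih =>
    rw [altSum_succ]
    revert h
    refine Fin.lastCases (fun h => ?_) (fun j h => ?_) j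
    · rw [sub_eq_zero]
      congr 1
      funext ω
      rw [← h (Fin.snoc (α := fun _ => Bool) ω false) true, Fin.update_snoc_last]
    · rw [ih _ j fun ω b => by rw [Fin.snoc_update, h],
        ih _ j fun ω b => by rw [Fin.snoc_update, h], sub_zero]

lemma altSum_single_one (n : ℕ) (b : A) : altSum A n (Pi.single (DCube.one n) b) = b := by
  induction n with
  | zero =>
    have : (fun i => i.elim0 : DCube 0) = DCube.one 0 := Subsingleton.elim _ _
    simp [altSum, this]
  | succ n ih =>
    have h1 : (fun ω : DCube n => (Pi.single (DCube.one (n + 1)) b : DCube (n + 1) → A)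
        (Fin.snoc (α := fun _ => Bool) ω true)) = Pi.single (DCube.one n) b := by
      funext ω
      simp only [Pi.single_apply]
      congr 1
      refine propext ⟨fun h => funext fun i => ?_, fun h => funext fun i => ?_⟩
      · simpa [DCube.one] using congrFun h i.castSucc
      · subst h
        refine Fin.lastCases ?_ (fun i => ?_) i <;> simp [DCube.one]
    have h2 : (fun ω : DCube n => (Pi.single (DCube.one (n + 1)) b : DCube (n + 1) → A)
        (Fin.snoc (α := fun _ => Bool) ω false)) = 0 := by
      funext ω
      rw [Pi.single_apply, if_neg]
      · rfl
      · intro h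
        simpa [DCube.one] using congrFun h (Fin.last n)
    rw [altSum_succ, h1, h2, ih, map_zero, sub_zero]

/-- The configuration equal to `a` on the edge through `ω₀` in direction `j` and `0` elsewhere. -/
def edgeFun {n : ℕ} (ω₀ : DCube n) (j : Fin n) (a : A) : DCube n → A :=
  fun ω => if ∀ i, i ≠ j → ω i = ω₀ i then a else 0

/-- The group of configurations generated by the configurations that are constant on an edge and
`0` elsewhere. -/
def edgeGroup (A : Type*) [AddCommGroup A] (n : ℕ) : AddSubgroup (DCube n → A) :=
  AddSubgroup.closure {g | ∃ ω₀ j a, g = edgeFun ω₀ j a}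

lemma altSum_eq_zero_of_mem_edgeGroup {n : ℕ} {g : DCube n → A} (hg : g ∈ edgeGroup A n) :
    altSum A n g = 0 := by
  refine (AddSubgroup.closure_le (altSum A n).ker).2 ?_ hg
  rintro _ ⟨ω₀, j, a, rfl⟩
  refine altSum_eq_zero _ j fun ω b => ?_
  unfold edgeFun
  congr 1
  refine propext (forall₂_congr fun i hi => ?_)
  rw [Function.update_of_ne hi]

/-- Modulo `edgeGroup`, a value can be moved along an edge by changing its sign, hence to
`(1, …, 1)`. -/
lemma exists_single_sub_single_mem {n : ℕ} (ω : DCube n) (a : A) :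
    ∃ b, Pi.single ω a - Pi.single (DCube.one n) b ∈ edgeGroup A n := by
  induction hm : (Finset.univ.filter fun i => ω i = false).card generalizing ω a with
  | zero =>
    have : ω = DCube.one n := funext fun i => by
      have := Finset.filter_eq_empty_iff.1 (Finset.card_eq_zero.1 hm) (Finset.mem_univ i)
      simpa [DCube.one] using this
    exact ⟨a, by rw [this, sub_self]; exact zero_mem _⟩
  | succ m ih =>
    obtain ⟨j, hj⟩ := Finset.card_pos.1
      (by omega : 0 < (Finset.univ.filter fun i => ω i = false).card)
    have hj' : ω j = false := by simpa using hj
    obtain ⟨b, hb⟩ := ih (Function.update ω j true) (-a) (by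
      have : (Finset.univ.filter fun i => Function.update ω j true i = false) =
          (Finset.univ.filter fun i => ω i = false).erase j := by
        ext i
        by_cases hi : i = j
        · subst hi; simp
        · simp [hi]
      rw [this, Finset.card_erase_of_mem hj, hm]
      rfl)
    refine ⟨b, ?_⟩
    have h1 : Pi.single ω a - Pi.single (DCube.one n) b = edgeFun ω j a +
        (Pi.single (Function.update ω j true) (-a) - Pi.single (DCube.one n) b) := by
      rw [← add_sub_assoc]
      congr 1
      funext η
      simp only [Pi.add_apply, edgeFun, Pi.single_apply]
      by_cases h : ∀ i, i ≠ j → η i = ω i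
      · have hη : η = Function.update ω j (η j) := by
          funext i
          by_cases hi : i = j
          · subst hi; simp
          · simp [hi, h i hi]
        rw [if_pos h]
        cases hb : η j
        · rw [hb, ← hj', Function.update_eq_self] at hη
          have : ω ≠ Function.update ω j true := fun e => by
            have := congrFun e j
            simp [hj'] at this
          simp [hη, this]
        · rw [hb] at hη
          have : Function.update ω j true ≠ ω := fun e => by
            have := congrFun e j
            simp [hj'] at this
          simp [hη, this]
      · have h2 : η ≠ ω := fun e => h fun i _ => by rw [e]
        have h3 : η ≠ Function.update ω j true := fun e => h fun i hi => by
          rw [e, Function.update_of_ne hi]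
        simp [h, h2, h3]
    rw [h1]
    exact add_mem (AddSubgroup.subset_closure ⟨ω, j, a, rfl⟩) hb

lemma exists_sub_single_mem {n : ℕ} (g : DCube n → A) :
    ∃ b, g - Pi.single (DCube.one n) b ∈ edgeGroup A n := by
  choose b hb using fun ω => exists_single_sub_single_mem ω (g ω)
  refine ⟨∑ ω, b ω, ?_⟩
  have h1 := sum_mem (t := Finset.univ) fun ω _ => hb ω
  rw [Finset.sum_sub_distrib, Finset.univ_sum_single] at h1
  convert h1
  exact map_sum (AddMonoidHom.single (fun _ => A) (DCube.one n)) b Finset.univ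

lemma hostKra_comp_init {e k : ℕ} {h : DCube k → A}
    (hh : h ∈ hostKra (fun i => if i < e then (⊤ : AddSubgroup A) else ⊥) k) :
    (fun ω : DCube (k + 1) => h fun i => ω i.castSucc) ∈
      hostKra (fun i => if i < e then (⊤ : AddSubgroup A) else ⊥) (k + 1) := by
  induction hh using AddSubgroup.closure_induction with
  | mem g hg =>
    obtain ⟨S, x, hx, rfl⟩ := hg
    refine AddSubgroup.subset_closure ⟨S.map Fin.castSuccEmb, x, by simpa using hx, ?_⟩
    simp
  | zero => exact zero_mem _
  | add g g' _ _ ih ih' => exact add_mem ih ih'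
  | neg g _ ih => exact neg_mem ih

lemma hostKra_ite_last {e k : ℕ} {h : DCube k → A}
    (hh : h ∈ hostKra (fun i => if i < e then (⊤ : AddSubgroup A) else ⊥) k) :
    (fun ω : DCube (k + 1) => if ω (Fin.last k) = true then h fun i => ω i.castSucc else 0) ∈
      hostKra (fun i => if i < e + 1 then (⊤ : AddSubgroup A) else ⊥) (k + 1) := by
  induction hh using AddSubgroup.closure_induction with
  | mem g hg =>
    obtain ⟨S, x, hx, rfl⟩ := hg
    refine AddSubgroup.subset_closure ⟨insert (Fin.last k) (S.map Fin.castSuccEmb), x, ?_, ?_⟩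
    · rw [Finset.card_insert_of_notMem (by simp [Fin.castSucc_ne_last])]
      simpa using hx
    · funext ω
      simp [ite_and]
  | zero =>
    refine Eq.mp (congrArg (· ∈ hostKra _ (k + 1)) ?_) (zero_mem _)
    funext ω
    simp
  | add g g' _ _ ih ih' =>
    refine Eq.mp (congrArg (· ∈ hostKra _ (k + 1)) ?_) (add_mem ih ih')
    funext ω
    simp only [Pi.add_apply]
    split_ifs <;> simp
  | neg g _ ih =>
    refine Eq.mp (congrArg (· ∈ hostKra _ (k + 1)) ?_) (neg_mem ih)
    funext ω
    simp only [Pi.neg_apply]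
    split_ifs <;> simp

/-- Split a configuration on `{0,1}^(k+1)` into its restriction to the lower face in the last
coordinate and the difference of its restrictions to the two faces; the vanishing condition in
dimension `e` for the former gives it in dimension `e - 1` for the latter. -/
lemma mem_hostKra_of_altSum {e k : ℕ} {g : DCube k → A}
    (hg : ∀ ρ : DCube e → DCube k, IsDCubeMorphism ρ → altSum A e (g ∘ ρ) = 0) :
    g ∈ hostKra (fun i => if i < e then (⊤ : AddSubgroup A) else ⊥) k := by
  induction k generalizing e with
  | zero =>
    cases e with
    | zero =>
      have : g = 0 := funext fun ω => hg (fun _ => ω) fun i => i.elim0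
      rw [this]
      exact zero_mem _
    | succ e =>
      refine AddSubgroup.subset_closure ⟨∅, g fun i => i.elim0, by simp, ?_⟩
      funext ω
      simp [Subsingleton.elim ω fun i => i.elim0]
  | succ k ih =>
    cases e with
    | zero =>
      have : g = 0 := funext fun ω => hg (fun _ => ω) fun i => by
        cases h : ω i
        · exact Or.inl fun _ => h
        · exact Or.inr (Or.inl fun _ => h)
      rw [this]
      exact zero_mem _
    | succ e =>
      have h0 : restrictLast A k false g ∈ _ := ih (e := e + 1) fun ρ hρ =>
        hg _ ((isDCubeMorphism_snoc false).comp hρ)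
      have h1 : restrictLast A k true g - restrictLast A k false g ∈ _ := ih (e := e) fun ρ hρ => by
        have := hg _ hρ.snoc_last
        rw [altSum_succ] at this
        simp only [Function.comp_apply, Fin.snoc_castSucc, Fin.snoc_last] at this
        rw [← map_sub] at this
        exact this
      refine Eq.mp (congrArg (· ∈ hostKra _ (k + 1)) ?_)
        (add_mem (hostKra_comp_init h0) (hostKra_ite_last h1))
      funext ω
      have hω : ∀ b, ω (Fin.last k) = b →
          Fin.snoc (α := fun _ => Bool) (fun i : Fin k => ω i.castSucc) b = ω := by
        rintro _ rfl
        exact Fin.snoc_init_self ω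
      cases hb : ω (Fin.last k)
      · simp [restrictLast, hb, hω _ hb]
      · simp [restrictLast, hb, hω _ hb]

lemma altSum_comp_eq_zero_of_mem_degreeCubes {s k : ℕ} {g : DCube k → A}
    (hg : g ∈ degreeCubes A s k) {ρ : DCube (s + 1) → DCube k} (hρ : IsDCubeMorphism ρ) :
    altSum A (s + 1) (g ∘ ρ) = 0 := by
  induction hg using AddSubgroup.closure_induction with
  | mem g hg =>
    obtain ⟨S, x, hx, rfl⟩ := hg
    by_cases hS : S.card ≤ s
    · -- Each coordinate of `ρ` depends on a single coordinate `t i`.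
      have ht : ∀ i, ∃ t : Fin (s + 1), ∀ ω j b, j ≠ t → ρ (Function.update ω j b) i = ρ ω i := by
        intro i
        rcases hρ i with h | h | ⟨m, h⟩ | ⟨m, h⟩
        · exact ⟨0, fun ω j b _ => by rw [h, h]⟩
        · exact ⟨0, fun ω j b _ => by rw [h, h]⟩
        · exact ⟨m, fun ω j b hj => by rw [h, h, Function.update_of_ne hj.symm]⟩
        · exact ⟨m, fun ω j b hj => by rw [h, h, Function.update_of_ne hj.symm]⟩
      choose t ht using ht
      obtain ⟨j, hj⟩ : ∃ j, j ∉ S.image t := by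
        by_contra! h
        have h1 : S.image t = Finset.univ := Finset.eq_univ_iff_forall.2 h
        have h2 := Finset.card_image_le (s := S) (f := t)
        rw [h1, Finset.card_univ, Fintype.card_fin] at h2
        omega
      refine altSum_eq_zero _ j fun ω b => ?_
      simp only [Function.comp_apply]
      congr 1
      refine propext (forall₂_congr fun i hi => ?_)
      rw [ht i ω j b fun h => hj (by rw [h]; exact Finset.mem_image_of_mem t hi)]
    · have hx0 : x = 0 := by simpa [hS] using hx
      subst hx0
      have : ((fun ω => if ∀ i ∈ S, ω i = true then (0 : A) else 0) ∘ ρ) = 0 := by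
        funext ω
        simp
      rw [this, map_zero]
  | zero => exact map_zero _
  | add g g' _ _ ih ih' =>
    have : (g + g') ∘ ρ = g ∘ ρ + g' ∘ ρ := rfl
    rw [this, map_add, ih, ih', add_zero]
  | neg g _ ih =>
    have : (-g) ∘ ρ = -(g ∘ ρ) := rfl
    rw [this, map_neg, ih, neg_zero]

/-- The Host–Kra cubes of degree `s` are the configurations all of whose restrictions to
`(s+1)`-dimensional cubes have alternating sum zero. -/
lemma mem_degreeCubes_iff {s k : ℕ} {g : DCube k → A} :
    g ∈ degreeCubes A s k ↔
      ∀ ρ : DCube (s + 1) → DCube k, IsDCubeMorphism ρ → altSum A (s + 1) (g ∘ ρ) = 0 := by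
  refine ⟨fun h ρ hρ => altSum_comp_eq_zero_of_mem_degreeCubes h hρ, fun h => ?_⟩
  have := mem_hostKra_of_altSum h
  simp only [Nat.lt_succ_iff] at this
  exact this

end AltSum

/-! ### The action on cubes -/

section CubeAction

variable {X Y : Type*} [MetricSpace X] [Cubespace X] {f : X → Y} {s : ℕ}
  {A : Type*} [AddCommGroup A] [AddAction A X]

/-- An action of `A` along the fibres of `f` that is free and preserves `(s+1)`-cubes when applied
at both ends of an edge. -/
structure IsEdgeAction (A : Type*) [AddCommGroup A] [AddAction A X] (f : X → Y) (s : ℕ) :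
    Prop where
  map_vadd : ∀ (a : A) (x : X), f (a +ᵥ x) = f x
  free : ∀ (a : A) (x : X), a +ᵥ x = x → a = 0
  edge_mem : ∀ (a : A), ∀ c ∈ cubes X (s + 1), ∀ (ω₀ : DCube (s + 1)) (j : Fin (s + 1)),
    (fun ω => if ∀ i, i ≠ j → ω i = ω₀ i then a +ᵥ c ω else c ω) ∈ cubes X (s + 1)

namespace IsEdgeAction

variable (K : IsEdgeAction A f s)

include K

lemma map_vadd_comp {k : ℕ} (g : DCube k → A) (c : DCube k → X) : f ∘ (g +ᵥ c) = f ∘ c :=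
  funext fun _ => K.map_vadd _ _

lemma edgeFun_vadd_mem (ω₀ : DCube (s + 1)) (j : Fin (s + 1)) (a : A) {c : DCube (s + 1) → X}
    (hc : c ∈ cubes X (s + 1)) : edgeFun ω₀ j a +ᵥ c ∈ cubes X (s + 1) := by
  refine Eq.mp (congrArg (· ∈ cubes X (s + 1)) ?_) (K.edge_mem a c hc ω₀ j)
  funext ω
  change _ = edgeFun ω₀ j a ω +ᵥ c ω
  unfold edgeFun
  split_ifs <;> simp

lemma vadd_mem_iff_of_mem_edgeGroup {g : DCube (s + 1) → A} (hg : g ∈ edgeGroup A (s + 1)) :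
    ∀ c : DCube (s + 1) → X, g +ᵥ c ∈ cubes X (s + 1) ↔ c ∈ cubes X (s + 1) := by
  induction hg using AddSubgroup.closure_induction with
  | mem g hg =>
    obtain ⟨ω₀, j, a, rfl⟩ := hg
    refine fun c => ⟨fun h => ?_, K.edgeFun_vadd_mem ω₀ j a⟩
    have := K.edgeFun_vadd_mem ω₀ j (-a) h
    rw [vadd_vadd] at this
    have h0 : edgeFun ω₀ j (-a) + edgeFun ω₀ j a = 0 := by
      funext ω
      simp only [edgeFun, Pi.add_apply]
      split_ifs <;> simp
    rwa [h0, zero_vadd] at this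
  | zero => simp
  | add g g' _ _ ih ih' =>
    intro c
    rw [add_vadd, ih, ih']
  | neg g _ ih =>
    intro c
    rw [← ih, vadd_vadd, add_neg_cancel, zero_vadd]

variable [MetricSpace Y] [Cubespace Y]

/-- Modulo configurations supported on edges, which preserve cubes, `g` is concentrated at
`(1, …, 1)`, where it is determined by its alternating sum; there uniqueness decides. -/
lemma vadd_mem_iff_altSum (H : IsDegreeFibration f s) (g : DCube (s + 1) → A)
    {c : DCube (s + 1) → X} (hc : c ∈ cubes X (s + 1)) :
    g +ᵥ c ∈ cubes X (s + 1) ↔ altSum A (s + 1) g = 0 := by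
  obtain ⟨b, hb⟩ := exists_sub_single_mem g
  have h1 := altSum_eq_zero_of_mem_edgeGroup hb
  rw [map_sub, altSum_single_one, sub_eq_zero] at h1
  have h2 := K.vadd_mem_iff_of_mem_edgeGroup hb
    ((Pi.single (DCube.one (s + 1)) b : DCube (s + 1) → A) +ᵥ c)
  rw [vadd_vadd, sub_add_cancel] at h2
  rw [h2, h1]
  constructor
  · intro h
    have h3 := H.uniq _ h _ hc (K.map_vadd_comp _ _) fun ω hω => by
      change (Pi.single (DCube.one (s + 1)) b : DCube (s + 1) → A) ω +ᵥ c ω = c ω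
      rw [Pi.single_eq_of_ne hω, zero_vadd]
    have h4 : (Pi.single (DCube.one (s + 1)) b : DCube (s + 1) → A) (DCube.one _) +ᵥ
        c (DCube.one _) = c (DCube.one _) := congrFun h3 _
    rw [Pi.single_eq_same] at h4
    exact K.free _ _ h4
  · rintro rfl
    rwa [Pi.single_zero, zero_vadd]

/-- In dimension at least `s + 2`, the lower faces form a corner, and by uniqueness on the upper
face the configuration is the completion of this corner. -/
lemma vadd_mem_of_altSum (H : IsDegreeFibration f s) {k : ℕ} {g : DCube k → A}
    (hg : ∀ ρ : DCube (s + 1) → DCube k, IsDCubeMorphism ρ → altSum A (s + 1) (g ∘ ρ) = 0)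
    {c : DCube k → X} (hc : c ∈ cubes X k) : g +ᵥ c ∈ cubes X k := by
  induction k with
  | zero => exact mem_cubes_zero _
  | succ k ih =>
    rcases lt_trichotomy k s with hk | rfl | hk
    · refine H.mem_cubes_of_le _ hk _ ?_
      rw [K.map_vadd_comp]
      exact H.fib.map_cubes _ c hc
    · exact (K.vadd_mem_iff_altSum H g hc).2 (hg id (isDCubeMorphism_perm id))
    · have hface : ∀ (i : Fin (k + 1)) (b : Bool), (g +ᵥ c) ∘
          (fun ω : DCube k => Fin.insertNth (α := fun _ => Bool) i b ω) ∈ cubes X k := by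
        intro i b
        have hδ := isDCubeMorphism_insertNth i b
        exact ih (fun ρ hρ => hg _ (hδ.comp hρ)) (comp_mem_cubes hδ hc)
      have hfg := K.map_vadd_comp g c
      obtain ⟨c', hc', h1, h2⟩ := H.fib.lift (k + 1) (f ∘ c) (H.fib.map_cubes _ c hc)
        (fun ω => (g +ᵥ c) ω.1) (fun i => hface i false) (fun ω => congrFun hfg ω.1)
      have hone : DCube.one (k + 1) =
          Fin.insertNth (α := fun _ => Bool) 0 true (DCube.one k) := by
        funext i
        refine Fin.cases ?_ (fun i => ?_) i <;> simp [DCube.one]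
      have hoff : ∀ ω, ω ≠ DCube.one (k + 1) → c' ω = (g +ᵥ c) ω := fun ω hω => h1 ⟨ω, hω⟩
      have hff : f ∘ c' = f ∘ (g +ᵥ c) := by
        funext ω
        by_cases hω : ω = DCube.one (k + 1)
        · rw [hω, hfg]
          exact h2
        · simp only [Function.comp_apply, hoff ω hω]
      have h3 := H.uniq.mono hk _ (comp_mem_cubes (isDCubeMorphism_insertNth 0 true) hc') _
        (hface 0 true) (by rw [← Function.comp_assoc, hff, Function.comp_assoc])
        fun ω hω => hoff _ fun he => hω <| by
          rw [hone] at he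
          exact Fin.insertNth_right_injective (α := fun _ => Bool) _ he
      have h4 : c' = g +ᵥ c := by
        funext ω
        by_cases hω : ω = DCube.one (k + 1)
        · rw [hω, hone]
          exact congrFun h3 _
        · exact hoff ω hω
      rwa [← h4]

/-- The configurations in `A` that map a given cube to a cube are the cubes of `D_s(A)`. -/
lemma vadd_mem_iff (H : IsDegreeFibration f s) {k : ℕ} {g : DCube k → A} {c : DCube k → X}
    (hc : c ∈ cubes X k) : g +ᵥ c ∈ cubes X k ↔ g ∈ degreeCubes A s k := by
  rw [mem_degreeCubes_iff]
  refine ⟨fun h ρ hρ => ?_, fun h => K.vadd_mem_of_altSum H h hc⟩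
  exact (K.vadd_mem_iff_altSum H (g ∘ ρ) (comp_mem_cubes hρ hc)).1 (comp_mem_cubes hρ h)

lemma cubeOrbit_eq (H : IsDegreeFibration f s)
    (htrans : ∀ x x' : X, f x = f x' → ∃ a : A, a +ᵥ x = x') {k : ℕ} {c : DCube k → X}
    (hc : c ∈ cubes X k) : cubeOrbit A s c = {c' | c' ∈ cubes X k ∧ f ∘ c' = f ∘ c} := by
  ext c'
  constructor
  · rintro ⟨a, ha, rfl⟩
    exact ⟨(K.vadd_mem_iff H hc).2 ha, K.map_vadd_comp a c⟩
  · rintro ⟨hc', hcc⟩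
    choose a ha using fun ω => htrans (c ω) (c' ω) (congrFun hcc ω).symm
    have hac : a +ᵥ c = c' := funext ha
    refine ⟨a, (K.vadd_mem_iff H hc).1 ?_, hac.symm⟩
    rwa [hac]

end IsEdgeAction

end CubeAction

/-! ### Lifting cubes along fibrations -/

section Lifting

variable {X Y : Type*} [MetricSpace X] [Cubespace X] [MetricSpace Y] [Cubespace Y] {f : X → Y}

/-- The number of coordinates of a vertex that are `1`. -/
def height {k : ℕ} (v : DCube k) : ℕ := (Finset.univ.filter fun i => v i = true).card

lemma height_and_lt {k : ℕ} {v w : DCube k} (h : (fun i => w i && v i) ≠ v) :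
    height (fun i => w i && v i) < height v := by
  refine Finset.card_lt_card ((Finset.ssubset_iff_of_subset fun i => ?_).2 ?_)
  · simp
  · by_contra! h1
    refine h (funext fun i => ?_)
    have := h1 i
    cases hv : v i <;> simp_all

/-- The face below a vertex `v` can be completed to a cube by changing the value at `v`, if the
faces below all smaller vertices are cubes already. -/
lemma IsFibration.exists_update_mem (hf : IsFibration f) {k : ℕ} {d : DCube k → Y}
    (hd : d ∈ cubes Y k) {c : DCube k → X} (hcd : f ∘ c = d) (v : DCube k)
    (hc : ∀ w, height w < height v → (fun ω => c fun i => ω i && w i) ∈ cubes X k) :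
    ∃ x, f x = d v ∧ (fun ω => Function.update c v x fun i => ω i && v i) ∈ cubes X k := by
  classical
  -- The face below `v`, parametrised by a cube whose coordinates are those of `v` equal to `1`.
  obtain ⟨m, ⟨e⟩⟩ : ∃ m, Nonempty ({i // v i = true} ≃ Fin m) := ⟨_, ⟨Fintype.equivFin _⟩⟩
  let φ : DCube m → DCube k := fun ω i => if h : v i = true then ω (e ⟨i, h⟩) else false
  let ψ : DCube k → DCube m := fun ω j => ω (e.symm j).1
  have hφ : IsDCubeMorphism φ := by
    intro i
    by_cases h : v i = true
    · exact Or.inr (Or.inr (Or.inl ⟨e ⟨i, h⟩, fun ω => by simp [φ, h]⟩))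
    · exact Or.inl fun ω => by simp [φ, h]
  have hψ : IsDCubeMorphism ψ := isDCubeMorphism_perm _
  have hψφ : ∀ ω, ψ (φ ω) = ω := fun ω => funext fun j => by
    simp [φ, ψ, (e.symm j).2]
  have hφψ : ∀ ω, φ (ψ ω) = fun i => ω i && v i := fun ω => funext fun i => by
    by_cases h : v i = true
    · simp [φ, ψ, h]
    · simp [φ, h]
  have hφone : φ (DCube.one m) = v := funext fun i => by
    by_cases h : v i = true <;> simp [φ, DCube.one, h]
  obtain ⟨c', hc', h1, h2⟩ := hf.lift m (d ∘ φ) (comp_mem_cubes hφ hd) (fun ω => c (φ ω.1))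
    (by
      cases m with
      | zero => trivial
      | succ m =>
        intro i
        -- The lower face in direction `i` lies below the vertex `w`.
        let w : DCube k := φ fun j => !decide (j = i)
        have hw : height w < height v := by
          have h3 : (fun l => w l && v l) = w := funext fun l => by
            by_cases h : v l = true <;> simp [w, φ, h]
          rw [← h3]
          refine height_and_lt fun h4 => ?_
          rw [h3, ← hφone] at h4
          have h5 := (hψφ fun j => !decide (j = i)).symm.trans
            ((congrArg ψ h4).trans (hψφ (DCube.one (m + 1))))
          simpa [DCube.one] using congrFun h5 i
        refine Eq.mp (congrArg (· ∈ cubes X m) ?_) (comp_mem_cubes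
          (hφ.comp (isDCubeMorphism_insertNth i false)) (hc w hw))
        funext ω
        simp only [Function.comp_apply, lowerFaceVertex]
        congr 1
        funext l
        by_cases h : v l = true
        · simp only [φ, w, h, dif_pos]
          by_cases hl : e ⟨l, h⟩ = i
          · simp [hl]
          · simp [hl]
        · simp [φ, h])
    (fun ω => congrFun hcd _)
  refine ⟨c' (DCube.one m), by rw [h2, ← hφone]; rfl,
    Eq.mp (congrArg (· ∈ cubes X k) ?_) (comp_mem_cubes hψ hc')⟩
  funext ω
  rw [← hφψ]
  by_cases h : ψ ω = DCube.one m
  · rw [Function.comp_apply, h, hφone, Function.update_self]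
  · rw [Function.comp_apply, Function.update_of_ne]
    · exact h1 ⟨_, h⟩
    · intro h3
      rw [← hφone] at h3
      exact h (by rw [← hψφ (ψ ω), h3, hψφ])

/-- Cubes lift along fibrations: start with any lift of the vertices and correct the values in the
order of increasing height. -/
lemma IsFibration.exists_lift_cube (hf : IsFibration f) {k : ℕ} {d : DCube k → Y}
    (hd : d ∈ cubes Y k) : ∃ c ∈ cubes X k, f ∘ c = d := by
  have key : ∀ t : ℕ, ∃ c : DCube k → X, f ∘ c = d ∧
      ∀ v, height v < t → (fun ω => c fun i => ω i && v i) ∈ cubes X k := by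
    intro t
    induction t with
    | zero =>
      choose g hg using hf.surjective
      exact ⟨fun ω => g (d ω), funext fun ω => hg _, fun v hv => absurd hv (Nat.not_lt_zero _)⟩
    | succ t ih =>
      obtain ⟨c, hcd, hc⟩ := ih
      have hx : ∀ v, ∃ x, f x = d v ∧ (height v = t →
          (fun ω => Function.update c v x fun i => ω i && v i) ∈ cubes X k) := by
        intro v
        by_cases hv : height v = t
        · obtain ⟨x, hx, h⟩ := hf.exists_update_mem hd hcd v fun w hw => hc w (hv ▸ hw)
          exact ⟨x, hx, fun _ => h⟩
        · exact ⟨c v, congrFun hcd v, fun h => absurd h hv⟩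
      choose x hx hxc using hx
      refine ⟨fun v => if height v = t then x v else c v, ?_, fun v hv => ?_⟩
      · funext v
        simp only [Function.comp_apply]
        split_ifs
        · exact hx v
        · exact congrFun hcd v
      · rcases Nat.lt_succ_iff_lt_or_eq.1 hv with hv | hv
        · refine Eq.mp (congrArg (· ∈ cubes X k) ?_) (hc v hv)
          funext ω
          refine (if_neg ?_).symm
          by_cases h : (fun i => ω i && v i) = v
          · rw [h]
            exact hv.ne
          · exact ((height_and_lt h).trans hv).ne
        · refine Eq.mp (congrArg (· ∈ cubes X k) ?_) (hxc v hv)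
          funext ω
          by_cases h : (fun i => ω i && v i) = v
          · rw [h, Function.update_self]
            exact (if_pos hv).symm
          · rw [Function.update_of_ne h]
            exact (if_neg (hv ▸ (height_and_lt h).ne)).symm
  obtain ⟨c, hcd, hc⟩ := key (k + 1)
  refine ⟨c, ?_, hcd⟩
  have := hc (DCube.one k) (Nat.lt_succ_of_le ((Finset.card_filter_le _ _).trans (by simp)))
  simpa [DCube.one] using this

end Lifting

/-! ### The structure theorem -/

theorem mainTheorem2 {X Y : Type*} [MetricSpace X] [CompactSpace X] [Cubespace X] [Nonempty X]
    [MetricSpace Y] [CompactSpace Y] [Cubespace Y]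
    (hXe : IsErgodicCubespace X) (hYe : IsErgodicCubespace Y)
    (hXg : HasGlueing X) (hYg : HasGlueing Y)
    (s : ℕ) (f : X → Y) (hf : IsFibration f) (hfd : RelDegreeAtMost f s)
    (hfe : IsRelErgodic f s) :
    Equivalence (structureRel f s) ∧
    ∃ (_ : AddCommGroup (StructureGroup f s)) (_ : AddAction (StructureGroup f s) X),
      -- `A(f)` is a compact (metrizable) abelian group acting continuously on `X`
      IsTopologicalAddGroup (StructureGroup f s) ∧ CompactSpace (StructureGroup f s) ∧
      TopologicalSpace.MetrizableSpace (StructureGroup f s) ∧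
      ContinuousVAdd (StructureGroup f s) X ∧
      -- addition is concatenation of pairs, and the class of `[x, x']` maps `x` to `x'`
      (∀ (x y z : X) (hxy : f x = f y) (hyz : f y = f z),
        StructureGroup.mk f s x y hxy + StructureGroup.mk f s y z hyz =
          StructureGroup.mk f s x z (hxy.trans hyz)) ∧
      (∀ (x x' : X) (h : f x = f x'), StructureGroup.mk f s x x' h +ᵥ x = x') ∧
      -- the action is free, and its orbits are precisely the fibres of `f`
      (∀ (a : StructureGroup f s) (x : X), a +ᵥ x = x → a = 0) ∧
      Set.range (fun x : X => AddAction.orbit (StructureGroup f s) x) =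
        Set.range (fun y : Y => f ⁻¹' {y}) ∧
      -- the pointwise action of `C^k(D_s(A))` preserves `C^k(X)`, is free there, and its orbits
      -- are precisely the fibres of `C^k(X) → C^k(Y)`
      ∀ k : ℕ,
        (∀ a ∈ degreeCubes (StructureGroup f s) s k, ∀ c ∈ cubes X k,
          (fun ω => a ω +ᵥ c ω) ∈ cubes X k) ∧
        (∀ a ∈ degreeCubes (StructureGroup f s) s k, ∀ c ∈ cubes X k,
          (fun ω => a ω +ᵥ c ω) = c → a = 0) ∧
        {O | ∃ c ∈ cubes X k, O = cubeOrbit (StructureGroup f s) s c} =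
          {F | ∃ d ∈ cubes Y k, F = {c | c ∈ cubes X k ∧ f ∘ c = d}} := by
  have H := isDegreeFibration hXe hXg hf hfd hfe
  let : AddCommGroup (StructureGroup f s) := H.addCommGroup
  let : AddAction (StructureGroup f s) X := H.addAction
  have htrans : ∀ x x' : X, f x = f x' → ∃ a : StructureGroup f s, a +ᵥ x = x' :=
    fun x x' h => ⟨StructureGroup.mk f s x x' h, H.act_mk h⟩
  have hmap : ∀ (a : StructureGroup f s) (x : X), f (a +ᵥ x) = f x :=
    fun a x => (H.map_act a x).symm
  have hfree : ∀ (a : StructureGroup f s) (x : X), a +ᵥ x = x → a = 0 :=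
    fun a x h => H.act_injective x (h.trans (H.act_zeroClass x).symm)
  have K : IsEdgeAction (StructureGroup f s) f s :=
    ⟨hmap, hfree, fun a c hc ω₀ j => H.act_edge_mem a hc ω₀ j⟩
  have horbit : ∀ x : X, AddAction.orbit (StructureGroup f s) x = f ⁻¹' {f x} := by
    intro x
    ext x'
    constructor
    · rintro ⟨a, rfl⟩
      exact hmap a x
    · exact fun h => htrans x x' (Set.mem_singleton_iff.1 h).symm
  refine ⟨H.equivalence, H.addCommGroup, H.addAction,
    { continuous_add := H.continuous_addClass, continuous_neg := H.continuous_negClass },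
    H.compactSpace_structureGroup, H.metrizableSpace_structureGroup,
    ⟨H.continuous_act⟩, fun x y z hxy hyz => H.mk_add_mk hxy hyz, fun x x' h => H.act_mk h,
    hfree, ?_, fun k => ⟨fun a ha c hc => (K.vadd_mem_iff H hc).2 ha,
      fun a _ c _ h => funext fun ω => hfree (a ω) (c ω) (congrFun h ω), ?_⟩⟩
  · ext O
    constructor
    · rintro ⟨x, rfl⟩
      exact ⟨f x, (horbit x).symm⟩
    · rintro ⟨y, rfl⟩
      obtain ⟨x, rfl⟩ := hf.surjective y
      exact ⟨x, horbit x⟩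
  · ext O
    constructor
    · rintro ⟨c, hc, rfl⟩
      exact ⟨f ∘ c, hf.map_cubes k c hc, K.cubeOrbit_eq H htrans hc⟩
    · rintro ⟨d, hd, rfl⟩
      obtain ⟨c, hc, rfl⟩ := hf.exists_lift_cube hd
      exact ⟨c, hc, (K.cubeOrbit_eq H htrans hc).symm⟩
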